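/- Let $U=[0,1]$ or $U=\{0,1\}$. For a pair $(A,B)$ of real $2\times 2$ Hurwitz matrices (all eigenvalues have negative real part) consider the planar switched system $$\dot x(t)=u(t)Ax(t)+(1-u(t))Bx(t),\qquad x(t)\in\mathbb R^2,$$ whose trajectories are the Carathéodory solutions on $[0,\infty)$ for arbitrary measurable switching functions $u:[0,\infty)\to U$. The system is GUES if there are $M,\lambda>0$ such that every trajectory satisfies $\|x(t)\|\le M e^{-\lambda t}\|x(0)\|$ for all $t>0$. A common Lyapunov function (CLF) of the system is a continuous function $V:\mathbb R^2\to[0,\infty)$ with $V(0)=0$ and $V(x)>0$ for $x\neq0$ that is strictly decreasing along every nonconstant trajectory. A piecewise-polynomial function (PPF) is a continuous function $V:\mathbb R^2\to\mathbb R$ together with a finite partition of $\mathbb R^2$ into cones $K_1,\dots,K_q$ based at zero (sets invariant under multiplication by positive reals) and polynomials $P_1,\dots,P_q$ with $V=P_j$ on $K_j$. Its total degree is $\max\{q,\deg P_1,\dots,\deg P_q\}$. Then the minimal total degree of a piecewise-polynomial CLF is not uniformly bounded over the GUES systems of this form: for every $N\in\mathbb N$ there are real $2\times2$ Hurwitz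 matrices $A,B$ such that the associated system is GUES, it admits a piecewise-polynomial CLF, and the minimal total degree of its piecewise-polynomial CLFs is greater than $N$. -/

import Mathlib

/-- The Euclidean plane `ℝ²`. -/
abbrev Plane : Type := EuclideanSpace ℝ (Fin 2)

/-- A real `2 × 2` matrix is Hurwitz if all its complex eigenvalues have negative real part. -/
def IsHurwitz (A : Matrix (Fin 2) (Fin 2) ℝ) : Prop :=
  ∀ μ ∈ spectrum ℂ (A.map (algebraMap ℝ ℂ)), μ.re < 0

/-- `γ`, restricted to `[0, ∞)`, is a trajectory of the switched system
`ẋ(t) = u(t) A x(t) + (1 - u(t)) B x(t)` for some measurable switching function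
`u : [0, ∞) → U`. Solutions are Carathéodory solutions, written in integral form.
The values of `u` and `γ` at negative times play no role. -/
def IsTrajectory (U : Set ℝ) (A B : Matrix (Fin 2) (Fin 2) ℝ) (γ : ℝ → Plane) : Prop :=
  ∃ u : ℝ → ℝ, Measurable u ∧ (∀ t, 0 ≤ t → u t ∈ U) ∧
    ContinuousOn γ (Set.Ici 0) ∧
    ∀ t, 0 ≤ t →
      γ t = γ 0 + ∫ s in (0 : ℝ)..t,
        Matrix.toEuclideanCLM (n := Fin 2) (𝕜 := ℝ) (u s • A + (1 - u s) • B) (γ s)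

/-- Global uniform exponential stability of the origin. -/
def IsGUES (U : Set ℝ) (A B : Matrix (Fin 2) (Fin 2) ℝ) : Prop :=
  ∃ M : ℝ, 0 < M ∧ ∃ r : ℝ, 0 < r ∧
    ∀ γ : ℝ → Plane, IsTrajectory U A B γ →
      ∀ t, 0 < t → ‖γ t‖ ≤ M * Real.exp (-r * t) * ‖γ 0‖

/-- The set of pairs of Hurwitz matrices whose switched system is GUES. -/
def xiGUES (U : Set ℝ) : Set (Matrix (Fin 2) (Fin 2) ℝ × Matrix (Fin 2) (Fin 2) ℝ) :=
  {p | IsHurwitz p.1 ∧ IsHurwitz p.2 ∧ IsGUES U p.1 p.2}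

/-- Common Lyapunov functions: continuous, positive definite, and strictly decreasing along
every nonconstant trajectory. -/
structure IsCLF (U : Set ℝ) (A B : Matrix (Fin 2) (Fin 2) ℝ) (V : Plane → ℝ) : Prop where
  continuous : Continuous V
  map_zero : V 0 = 0
  pos : ∀ x, x ≠ 0 → 0 < V x
  strictAnti : ∀ γ : ℝ → Plane, IsTrajectory U A B γ → (∃ t, 0 ≤ t ∧ γ t ≠ γ 0) →
    StrictAntiOn (fun t => V (γ t)) (Set.Ici 0)

/-- A cone based at zero: a set that is invariant under multiplication by positive numbers. -/
def IsConeAtZero {n : ℕ} (K : Set (EuclideanSpace ℝ (Fin n))) : Prop :=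
  ∀ x ∈ K, ∀ c : ℝ, 0 < c → c • x ∈ K

/-- A piecewise-polynomial function: a continuous function on `ℝⁿ` together with finitely many
cones that partition `ℝⁿ`, on each of which the function agrees with a given polynomial. -/
structure PPF (n : ℕ) where
  toFun : EuclideanSpace ℝ (Fin n) → ℝ
  continuous : Continuous toFun
  numCones : ℕ
  cone : Fin numCones → Set (EuclideanSpace ℝ (Fin n))
  isCone : ∀ j, IsConeAtZero (cone j)
  disjoint : Pairwise fun i j => Disjoint (cone i) (cone j)
  cover : ⋃ j, cone j = Set.univ
  poly : Fin numCones → MvPolynomial (Fin n) ℝ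
  eq_poly : ∀ j, ∀ x ∈ cone j, toFun x = MvPolynomial.eval (fun i => x i) (poly j)

/-- The total degree of a PPF: the maximum of the number of cones and of the degrees of the
polynomials. -/
def PPF.totalDegree {n : ℕ} (V : PPF n) : ℕ :=
  max V.numCones (Finset.univ.sup fun j => (V.poly j).totalDegree)

/-- The total degrees of all piecewise-polynomial common Lyapunov functions of the system. -/
def ppfCLFDegrees (U : Set ℝ) (A B : Matrix (Fin 2) (Fin 2) ℝ) : Set ℕ :=
  {d | ∃ V : PPF 2, IsCLF U A B V.toFun ∧ V.totalDegree = d}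

section

open Set Filter Topology MeasureTheory

/-! The pair consists of a focus and a node, each damped by `e`. Without damping, the focus moves
along logarithmic spirals and the node preserves `x 0 + p * x 1`, pushing points along its level
lines toward the horizontal axis. The slope `p` is critical (`exists_critical_slope`): the spiral
from `planeE` reaches the line `x 0 + p * x 1 = -1` at time `σ`, and the shear then leads
asymptotically to `-planeE`. The undamped system thus has a limiting closed curve, part of which is
a spiral arc.

For every `e > 0` there is nevertheless a polynomial CLF (`exists_form_lyapunov`). The supremum over
`t ≥ 0` of `|spiralObs p t x|` does not increase along either undamped flow; replacing it by an
integral of a high even power gives a form, and the damping absorbs the approximation error.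

As `e` tends to `0`, trajectories nearly close up, so the value of any CLF on a scaled spiral arc is
squeezed between two values on one ray (`exists_squeeze`). If degrees stayed at most `N`, each CLF
would satisfy a nonzero algebraic relation of bounded degree (`PPF.exists_algebraic_relation`).
After normalization, compactness gives a nonzero limiting relation that holds on all scaled spiral
arcs, with the limiting ray polynomial as the value. Transcendence of the spiral
(`eq_zero_of_eval_spiral`) excludes this; `exists_large_degree` carries out the argument. -/

/-! ### Decay along trajectories from differential inequalities -/

lemma toEuclideanCLM_convexComb (A B : Matrix (Fin 2) (Fin 2) ℝ) (a : ℝ) (x : Plane) :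
    Matrix.toEuclideanCLM (n := Fin 2) (𝕜 := ℝ) (a • A + (1 - a) • B) x =
      a • Matrix.toEuclideanCLM (n := Fin 2) (𝕜 := ℝ) A x +
        (1 - a) • Matrix.toEuclideanCLM (n := Fin 2) (𝕜 := ℝ) B x := by
  simp only [map_add, map_smul, add_apply, smul_apply]

/-- The velocity of a trajectory is integrable on bounded intervals of nonnegative times. -/
lemma intervalIntegrable_velocity {U : Set ℝ} (hU : U ⊆ Icc 0 1)
    (A B : Matrix (Fin 2) (Fin 2) ℝ) {γ : ℝ → Plane} {u : ℝ → ℝ} (hu : Measurable u)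
    (huU : ∀ t, 0 ≤ t → u t ∈ U) (hγ : ContinuousOn γ (Ici 0)) {a b : ℝ}
    (ha : 0 ≤ a) (hb : 0 ≤ b) :
    IntervalIntegrable (fun s => Matrix.toEuclideanCLM (n := Fin 2) (𝕜 := ℝ)
      (u s • A + (1 - u s) • B) (γ s)) volume a b := by
  have hsub : uIcc a b ⊆ Ici 0 := by
    intro x hx
    rcases mem_uIcc.1 hx with h | h
    · exact ha.trans h.1
    · exact hb.trans h.1
  have hu1 : IntervalIntegrable u volume a b := by
    rw [intervalIntegrable_iff]
    refine Measure.integrableOn_of_bounded (M := 1) (by simp) hu.aestronglyMeasurable ?_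
    refine (ae_restrict_iff' measurableSet_uIoc).2 (Eventually.of_forall fun x hx => ?_)
    have h := hU (huU x (hsub (uIoc_subset_uIcc hx)))
    rw [Real.norm_eq_abs, abs_le]
    constructor <;> linarith [h.1, h.2]
  have hu2 : IntervalIntegrable (fun s => 1 - u s) volume a b :=
    (intervalIntegrable_const).sub hu1
  have hc : ∀ C : Matrix (Fin 2) (Fin 2) ℝ, ContinuousOn
      (fun s => Matrix.toEuclideanCLM (n := Fin 2) (𝕜 := ℝ) C (γ s)) (uIcc a b) := fun C =>
    (ContinuousLinearMap.continuous _).comp_continuousOn (hγ.mono hsub)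
  simp only [toEuclideanCLM_convexComb]
  exact (hu1.smul_continuousOn (hc A)).add (hu2.smul_continuousOn (hc B))

/-- If a differentiable function satisfies `V' ≤ -kV` along both vector fields, it decays at
rate `k` along all trajectories of the switched system. -/
lemma IsTrajectory.le_exp_mul {U : Set ℝ} (hU : U ⊆ Icc 0 1) {A B : Matrix (Fin 2) (Fin 2) ℝ}
    {γ : ℝ → Plane} (hγ : IsTrajectory U A B γ) {V : Plane → ℝ} {V' : Plane → Plane →L[ℝ] ℝ}
    (hV : ∀ x, HasFDerivAt V (V' x) x) {k : ℝ}
    (hA : ∀ x, V' x (Matrix.toEuclideanCLM (n := Fin 2) (𝕜 := ℝ) A x) ≤ -k * V x)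
    (hB : ∀ x, V' x (Matrix.toEuclideanCLM (n := Fin 2) (𝕜 := ℝ) B x) ≤ -k * V x)
    {s t : ℝ} (hs : 0 ≤ s) (hst : s ≤ t) :
    V (γ t) ≤ V (γ s) * Real.exp (-k * (t - s)) := by
  obtain ⟨u, hu, huU, hc, hint⟩ := hγ
  have hII : ∀ {a b : ℝ}, 0 ≤ a → 0 ≤ b → _ :=
    fun {a b} ha hb => intervalIntegrable_velocity hU A B hu huU hc (a := a) (b := b) ha hb
  have hVc : Continuous V := continuous_iff_continuousAt.2 fun x => (hV x).continuousAt
  have hdiff : ∀ a b, 0 ≤ a → 0 ≤ b → γ b - γ a = ∫ s in a..b,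
      Matrix.toEuclideanCLM (n := Fin 2) (𝕜 := ℝ) (u s • A + (1 - u s) • B) (γ s) := by
    intro a b ha hb
    rw [hint b hb, hint a ha, add_sub_add_left_eq_sub,
      intervalIntegral.integral_interval_sub_left (hII le_rfl hb) (hII le_rfl ha)]
  set TA := Matrix.toEuclideanCLM (n := Fin 2) (𝕜 := ℝ) A with hTA
  set TB := Matrix.toEuclideanCLM (n := Fin 2) (𝕜 := ℝ) B with hTB
  have hvel : ∀ (a : ℝ), a ∈ Icc (0 : ℝ) 1 → ∀ x : Plane,
      ‖a • TA x + (1 - a) • TB x‖ ≤ (‖TA‖ + ‖TB‖) * ‖x‖ := by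
    intro a ha x
    refine (norm_add_le _ _).trans ?_
    rw [norm_smul, norm_smul, Real.norm_of_nonneg ha.1, Real.norm_of_nonneg (by linarith [ha.2]),
      add_mul]
    have h1 := TA.le_opNorm x
    have h2 := TB.le_opNorm x
    have h3 := norm_nonneg (TA x)
    have h4 := norm_nonneg (TB x)
    have h5 : a * ‖TA x‖ ≤ 1 * ‖TA x‖ := by gcongr; exact ha.2
    have h6 : (1 - a) * ‖TB x‖ ≤ 1 * ‖TB x‖ := by gcongr; linarith [ha.1]
    linarith
  -- The switching is only measurable, so `V ∘ γ` need not be differentiable. Gronwall's lemma needs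
  -- only a bound on right difference quotients, obtained by freezing the state at `γ x` in the
  -- averaged velocity, with errors controlled by `η`.
  have key : ∀ x ∈ Ico s t, ∀ r : ℝ, -k * V (γ x) < r →
      ∃ᶠ z in 𝓝[>] x, (z - x)⁻¹ * (V (γ z) - V (γ x)) < r := by
    intro x hx r hr
    have hx0 : 0 ≤ x := hs.trans hx.1
    apply Eventually.frequently
    set L := V' (γ x) with hL
    set K := ‖TA‖ + ‖TB‖ with hK
    have hK0 : 0 ≤ K := by positivity
    have hcx : Tendsto γ (𝓝[>] x) (𝓝 (γ x)) :=
      ((hc x hx0).mono fun y hy => hx0.trans (le_of_lt hy))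
    obtain ⟨η, hη, hη'⟩ : ∃ η : ℝ, 0 < η ∧
        -k * V (γ x) + ‖L‖ * (K * η) + η * (K * (‖γ x‖ + η)) < r := by
      have hcont : Tendsto (fun η : ℝ => -k * V (γ x) + ‖L‖ * (K * η) + η * (K * (‖γ x‖ + η)))
          (𝓝[>] 0) (𝓝 (-k * V (γ x))) := by
        have : Continuous
            (fun η : ℝ => -k * V (γ x) + ‖L‖ * (K * η) + η * (K * (‖γ x‖ + η))) := by fun_prop
        have h := (this.tendsto 0).mono_left (nhdsWithin_le_nhds (s := Ioi 0))
        simpa using h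
      obtain ⟨η, h1, h2⟩ := ((hcont.eventually_lt_const hr).and self_mem_nhdsWithin).exists
      exact ⟨η, h2, h1⟩
    have hclose : ∀ᶠ z in 𝓝[>] x, ‖γ z - γ x‖ < η := by
      have := hcx.eventually (Metric.ball_mem_nhds _ hη)
      filter_upwards [this] with z hz
      rwa [← dist_eq_norm]
    obtain ⟨b, hb, hball⟩ := (mem_nhdsGT_iff_exists_Ioo_subset).1 hclose
    have hlo := hcx.eventually ((hV (γ x)).isLittleO.def hη)
    filter_upwards [hlo, Ioo_mem_nhdsGT hb] with z hz hzb
    have hxz : 0 < z - x := sub_pos.2 hzb.1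
    have hz0 : 0 ≤ z := hx0.trans hzb.1.le
    have hclose' : ∀ w ∈ Icc x z, ‖γ w - γ x‖ ≤ η := by
      intro w hw
      rcases hw.1.eq_or_lt with h | h
      · rw [← h, sub_self, norm_zero]; exact hη.le
      · exact le_of_lt (hball ⟨h, hw.2.trans_lt hzb.2⟩)
    have hmove : ‖γ z - γ x‖ ≤ K * (‖γ x‖ + η) * (z - x) := by
      rw [hdiff x z hx0 hz0]
      have := intervalIntegral.norm_integral_le_of_norm_le_const (a := x) (b := z)
        (C := K * (‖γ x‖ + η)) (f := fun s => Matrix.toEuclideanCLM (n := Fin 2) (𝕜 := ℝ)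
          (u s • A + (1 - u s) • B) (γ s)) (fun w hw => by
          rw [uIoc_of_le hzb.1.le] at hw
          rw [toEuclideanCLM_convexComb]
          refine (hvel _ (hU (huU w (hx0.trans hw.1.le))) _).trans ?_
          gcongr
          have := hclose' w ⟨hw.1.le, hw.2⟩
          have h2 := norm_add_le (γ x) (γ w - γ x)
          rw [add_sub_cancel] at h2
          linarith)
      rwa [abs_of_pos hxz] at this
    have hlin : L (γ z - γ x) ≤ (-k * V (γ x) + ‖L‖ * (K * η)) * (z - x) := by
      rw [hdiff x z hx0 hz0, ← ContinuousLinearMap.intervalIntegral_comp_comm L (hII hx0 hz0)]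
      have hi : IntervalIntegrable (fun s => L (Matrix.toEuclideanCLM (n := Fin 2) (𝕜 := ℝ)
          (u s • A + (1 - u s) • B) (γ s))) volume x z := by
        have h := hII hx0 hz0
        rw [intervalIntegrable_iff] at h ⊢
        exact L.integrable_comp h
      have := intervalIntegral.integral_mono_on hzb.1.le hi
        (intervalIntegrable_const (c := -k * V (γ x) + ‖L‖ * (K * η))) (fun w hw => by
          have hw0 : 0 ≤ w := hx0.trans hw.1
          have hu01 := hU (huU w hw0)
          rw [toEuclideanCLM_convexComb]
          have hsplit : u w • TA (γ w) + (1 - u w) • TB (γ w) =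
              (u w • TA (γ x) + (1 - u w) • TB (γ x)) +
              (u w • TA (γ w - γ x) + (1 - u w) • TB (γ w - γ x)) := by
            simp only [map_sub, smul_sub]; abel
          rw [hsplit, map_add]
          have h1 : L (u w • TA (γ x) + (1 - u w) • TB (γ x)) ≤ -k * V (γ x) := by
            rw [map_add, map_smul, map_smul, smul_eq_mul, smul_eq_mul]
            have hA1 := mul_le_mul_of_nonneg_left (hA (γ x)) hu01.1
            have hB1 := mul_le_mul_of_nonneg_left (hB (γ x)) (sub_nonneg.2 hu01.2)
            linarith
          have h2 : L (u w • TA (γ w - γ x) + (1 - u w) • TB (γ w - γ x)) ≤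
              ‖L‖ * (K * η) := by
            refine (le_abs_self _).trans ((L.le_opNorm _).trans ?_)
            gcongr
            refine (hvel _ hu01 _).trans ?_
            gcongr
            exact hclose' w hw
          exact add_le_add h1 h2)
      rw [intervalIntegral.integral_const, smul_eq_mul] at this
      linarith
    rw [inv_mul_lt_iff₀ hxz]
    have h3 : V (γ z) - V (γ x) - L (γ z - γ x) ≤ η * (K * (‖γ x‖ + η) * (z - x)) :=
      (le_abs_self _).trans (hz.trans (by gcongr))
    have h4 := mul_lt_mul_of_pos_right hη' hxz
    nlinarith
  have hcont : ContinuousOn (fun x => V (γ x)) (Icc s t) :=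
    hVc.comp_continuousOn (hc.mono fun y hy => hs.trans hy.1)
  have := le_gronwallBound_of_liminf_deriv_right_le (f := fun x => V (γ x))
    (f' := fun x => -k * V (γ x)) (δ := V (γ s)) (K := -k) (ε := 0) hcont key le_rfl
    (fun x _ => by simp) t ⟨hst, le_rfl⟩
  rwa [gronwallBound_ε0] at this

/-- A trajectory that starts away from the origin never reaches it. -/
lemma IsTrajectory.ne_zero {U : Set ℝ} (hU : U ⊆ Icc 0 1) {A B : Matrix (Fin 2) (Fin 2) ℝ}
    {γ : ℝ → Plane} (hγ : IsTrajectory U A B γ) (h0 : γ 0 ≠ 0) {t : ℝ} (ht : 0 ≤ t) :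
    γ t ≠ 0 := by
  set TA := Matrix.toEuclideanCLM (n := Fin 2) (𝕜 := ℝ) A with hTA
  set TB := Matrix.toEuclideanCLM (n := Fin 2) (𝕜 := ℝ) B with hTB
  -- The decay lemma does not require a positive function: applied to `-‖y‖ ^ 2` it bounds the norm
  -- from below.
  have hV : ∀ x : Plane, HasFDerivAt (fun y : Plane => -‖y‖ ^ 2) (-(2 • innerSL ℝ x)) x :=
    fun x => (hasStrictFDerivAt_norm_sq x).hasFDerivAt.neg
  have hT : ∀ T : Plane →L[ℝ] Plane, ‖T‖ ≤ ‖TA‖ + ‖TB‖ → ∀ x : Plane,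
      (-(2 • innerSL ℝ x)) (T x) ≤ -(2 * (‖TA‖ + ‖TB‖)) * (-‖x‖ ^ 2) := by
    intro T hTn x
    have h1 := neg_le_of_abs_le (abs_real_inner_le_norm x (T x))
    have h2 := T.le_opNorm x
    have h3 : ‖x‖ * ‖T x‖ ≤ ‖x‖ * ((‖TA‖ + ‖TB‖) * ‖x‖) := by
      gcongr
      exact h2.trans (by gcongr)
    simp only [neg_apply, smul_apply, innerSL_apply_apply,
      nsmul_eq_mul]
    push_cast
    nlinarith
  have := hγ.le_exp_mul hU hV (hT TA (by simp)) (hT TB (by simp)) le_rfl ht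
  intro h
  rw [h, norm_zero] at this
  have hp : 0 < ‖γ 0‖ ^ 2 * Real.exp (-(2 * (‖TA‖ + ‖TB‖)) * (t - 0)) := by positivity
  have h2 : (0 : ℝ) ^ 2 = 0 := by norm_num
  rw [h2] at this
  linarith

/-- A continuous positive definite function with exponential decay is a common Lyapunov
function. -/
lemma isCLF_of_hasFDerivAt {U : Set ℝ} (hU : U ⊆ Icc 0 1) {A B : Matrix (Fin 2) (Fin 2) ℝ}
    {V : Plane → ℝ} {V' : Plane → Plane →L[ℝ] ℝ} (hV : ∀ x, HasFDerivAt V (V' x) x)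
    (h0 : V 0 = 0) (hpos : ∀ x, x ≠ 0 → 0 < V x) {k : ℝ} (hk : 0 < k)
    (hA : ∀ x, V' x (Matrix.toEuclideanCLM (n := Fin 2) (𝕜 := ℝ) A x) ≤ -k * V x)
    (hB : ∀ x, V' x (Matrix.toEuclideanCLM (n := Fin 2) (𝕜 := ℝ) B x) ≤ -k * V x) :
    IsCLF U A B V where
  continuous := continuous_iff_continuousAt.2 fun x => (hV x).continuousAt
  map_zero := h0
  pos := hpos
  strictAnti := by
    rintro γ hγ ⟨T, hT, hne⟩
    have hγ0 : γ 0 ≠ 0 := by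
      intro h
      have := hγ.le_exp_mul hU hV hA hB le_rfl hT
      rw [h, h0, zero_mul] at this
      refine hne ?_
      rw [h]
      by_contra hcon
      exact absurd (hpos _ hcon) (not_lt.2 this)
    intro s hs t ht hst
    have h1 := hγ.le_exp_mul hU hV hA hB hs hst.le
    have h2 := hpos _ (hγ.ne_zero hU hγ0 hs)
    have h3 : Real.exp (-k * (t - s)) < 1 := by
      rw [Real.exp_lt_one_iff]
      nlinarith
    calc V (γ t) ≤ V (γ s) * Real.exp (-k * (t - s)) := h1
      _ < V (γ s) * 1 := by gcongr
      _ = V (γ s) := mul_one _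

/-- A positively homogeneous function that is continuous and positive off the origin is
comparable to a power of the norm. -/
lemma exists_norm_pow_bounds {V : Plane → ℝ} (hc : Continuous V) (hpos : ∀ x, x ≠ 0 → 0 < V x)
    {d : ℕ} (hd : d ≠ 0) (hhom : ∀ (a : ℝ) x, V (a • x) = a ^ d * V x) :
    ∃ a b : ℝ, 0 < a ∧ 0 < b ∧ ∀ x, a * ‖x‖ ^ d ≤ V x ∧ V x ≤ b * ‖x‖ ^ d := by
  have hne : (Metric.sphere (0 : Plane) 1).Nonempty := NormedSpace.sphere_nonempty.2 zero_le_one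
  obtain ⟨x₁, h₁, hmin⟩ := (isCompact_sphere (0 : Plane) 1).exists_isMinOn hne hc.continuousOn
  obtain ⟨x₂, h₂, hmax⟩ := (isCompact_sphere (0 : Plane) 1).exists_isMaxOn hne hc.continuousOn
  have hn : ∀ x ∈ Metric.sphere (0 : Plane) 1, x ≠ 0 := fun x hx h => by
    simp [h] at hx
  refine ⟨V x₁, V x₂, hpos _ (hn _ h₁), hpos _ (hn _ h₂), fun x => ?_⟩
  rcases eq_or_ne x 0 with rfl | hx
  · have : V 0 = 0 := by simpa [zero_pow hd] using hhom 0 0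
    simp [this, zero_pow hd]
  · have hx' : 0 < ‖x‖ := norm_pos_iff.2 hx
    have hmem : ‖x‖⁻¹ • x ∈ Metric.sphere (0 : Plane) 1 := by
      simp [norm_smul, hx'.ne']
    have hVx : V x = ‖x‖ ^ d * V (‖x‖⁻¹ • x) := by
      rw [← hhom, smul_smul, mul_inv_cancel₀ hx'.ne', one_smul]
    rw [hVx, mul_comm (V x₁), mul_comm (V x₂)]
    exact ⟨by gcongr; exact hmin hmem, by gcongr; exact hmax hmem⟩

/-- Homogeneity makes `V` comparable to `‖x‖ ^ d`, so decay of `V` at rate `k` becomes decay of the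
norm at rate `k / d`. -/
lemma isGUES_of_hasFDerivAt {U : Set ℝ} (hU : U ⊆ Icc 0 1) {A B : Matrix (Fin 2) (Fin 2) ℝ}
    {V : Plane → ℝ} {V' : Plane → Plane →L[ℝ] ℝ} (hV : ∀ x, HasFDerivAt V (V' x) x)
    (hpos : ∀ x, x ≠ 0 → 0 < V x) {d : ℕ} (hd : d ≠ 0)
    (hhom : ∀ (a : ℝ) x, V (a • x) = a ^ d * V x) {k : ℝ} (hk : 0 < k)
    (hA : ∀ x, V' x (Matrix.toEuclideanCLM (n := Fin 2) (𝕜 := ℝ) A x) ≤ -k * V x)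
    (hB : ∀ x, V' x (Matrix.toEuclideanCLM (n := Fin 2) (𝕜 := ℝ) B x) ≤ -k * V x) :
    IsGUES U A B := by
  have hVc : Continuous V := continuous_iff_continuousAt.2 fun x => (hV x).continuousAt
  obtain ⟨a, b, ha, hb, hab⟩ := exists_norm_pow_bounds hVc hpos hd hhom
  have hd0 : (0 : ℝ) < d := by exact_mod_cast Nat.pos_of_ne_zero hd
  refine ⟨max 1 (b / a), by positivity, k / d, by positivity, fun γ hγ t ht => ?_⟩
  have h1 := hγ.le_exp_mul hU hV hA hB le_rfl ht.le
  have h2 : a * ‖γ t‖ ^ d ≤ b * ‖γ 0‖ ^ d * Real.exp (-k * (t - 0)) :=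
    ((hab _).1.trans h1).trans (by gcongr; exact (hab _).2)
  -- A base that is at least `1` is dominated by its `d`-th power, which avoids a `d`-th root in the
  -- constant.
  have h3 : b / a ≤ max 1 (b / a) ^ d :=
    (le_max_right _ _).trans (le_self_pow₀ (le_max_left _ _) hd)
  refine le_of_pow_le_pow_left₀ hd (by positivity) ?_
  have h4 : Real.exp (-(k / d) * t) ^ d = Real.exp (-k * (t - 0)) := by
    rw [← Real.exp_nat_mul]
    congr 1
    field_simp
    ring
  rw [mul_pow, mul_pow, h4]
  calc ‖γ t‖ ^ d ≤ b / a * Real.exp (-k * (t - 0)) * ‖γ 0‖ ^ d := by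
        rw [div_mul_eq_mul_div, div_mul_eq_mul_div, le_div_iff₀ ha]
        linarith
    _ ≤ _ := by gcongr

/-! ### The two matrices and their flows -/

/-- A focus with eigenvalues `-1 - e ± i`. -/
def spiralMatrix (e : ℝ) : Matrix (Fin 2) (Fin 2) ℝ := !![-1 - e, -1; 1, -1 - e]

/-- A node with eigenvalues `-e` and `-1 - e`. -/
def shearMatrix (p e : ℝ) : Matrix (Fin 2) (Fin 2) ℝ := !![-e, p; 0, -1 - e]

/-- The flow of `spiralMatrix 0`. -/
noncomputable def spiralFlow (t : ℝ) (x : Plane) : Plane :=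
  !₂[Real.exp (-t) * (Real.cos t * x 0 - Real.sin t * x 1),
    Real.exp (-t) * (Real.sin t * x 0 + Real.cos t * x 1)]

/-- The flow of `shearMatrix p 0`. -/
noncomputable def shearFlow (p t : ℝ) (x : Plane) : Plane :=
  !₂[x 0 + p * (1 - Real.exp (-t)) * x 1, Real.exp (-t) * x 1]

/-- The value of the functional `x ↦ x 0 + p * x 1` along the spiral flow. -/
noncomputable def spiralObs (p t : ℝ) (x : Plane) : ℝ :=
  Real.exp (-t) * ((x 0 + p * x 1) * Real.cos t + (p * x 0 - x 1) * Real.sin t)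

/-- The first basis vector. -/
noncomputable def planeE : Plane := !₂[1, 0]

@[simp] lemma planeE_zero : planeE 0 = 1 := rfl
@[simp] lemma planeE_one : planeE 1 = 0 := rfl

lemma spiralFlow_apply_zero (t : ℝ) (x : Plane) :
    spiralFlow t x 0 = Real.exp (-t) * (Real.cos t * x 0 - Real.sin t * x 1) := rfl
lemma spiralFlow_apply_one (t : ℝ) (x : Plane) :
    spiralFlow t x 1 = Real.exp (-t) * (Real.sin t * x 0 + Real.cos t * x 1) := rfl
lemma shearFlow_apply_zero (p t : ℝ) (x : Plane) :
    shearFlow p t x 0 = x 0 + p * (1 - Real.exp (-t)) * x 1 := rfl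
lemma shearFlow_apply_one (p t : ℝ) (x : Plane) :
    shearFlow p t x 1 = Real.exp (-t) * x 1 := rfl

lemma spiralMatrix_apply_zero (e : ℝ) (x : Plane) :
    Matrix.toEuclideanCLM (n := Fin 2) (𝕜 := ℝ) (spiralMatrix e) x 0 =
      (-1 - e) * x 0 - x 1 := by
  rw [Matrix.ofLp_toEuclideanCLM]
  simp [spiralMatrix, Matrix.mulVec, dotProduct, Fin.sum_univ_two]
  ring
lemma spiralMatrix_apply_one (e : ℝ) (x : Plane) :
    Matrix.toEuclideanCLM (n := Fin 2) (𝕜 := ℝ) (spiralMatrix e) x 1 =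
      x 0 + (-1 - e) * x 1 := by
  rw [Matrix.ofLp_toEuclideanCLM]
  simp [spiralMatrix, Matrix.mulVec, dotProduct, Fin.sum_univ_two]
lemma shearMatrix_apply_zero (p e : ℝ) (x : Plane) :
    Matrix.toEuclideanCLM (n := Fin 2) (𝕜 := ℝ) (shearMatrix p e) x 0 =
      -e * x 0 + p * x 1 := by
  rw [Matrix.ofLp_toEuclideanCLM]
  simp [shearMatrix, Matrix.mulVec, dotProduct, Fin.sum_univ_two]
lemma shearMatrix_apply_one (p e : ℝ) (x : Plane) :
    Matrix.toEuclideanCLM (n := Fin 2) (𝕜 := ℝ) (shearMatrix p e) x 1 =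
      (-1 - e) * x 1 := by
  rw [Matrix.ofLp_toEuclideanCLM]
  simp [shearMatrix, Matrix.mulVec, dotProduct, Fin.sum_univ_two]

lemma plane_ext {x y : Plane} (h0 : x 0 = y 0) (h1 : x 1 = y 1) : x = y := by
  ext i
  fin_cases i
  · exact h0
  · exact h1

lemma hasDerivAt_plane {γ : ℝ → Plane} {v : Plane} {t : ℝ}
    (h0 : HasDerivAt (fun s => γ s 0) (v 0) t) (h1 : HasDerivAt (fun s => γ s 1) (v 1) t) :
    HasDerivAt γ v t := by
  have h : HasDerivAt (fun s => (γ s).ofLp) v.ofLp t := by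
    refine hasDerivAt_pi.2 fun i => ?_
    fin_cases i
    · exact h0
    · exact h1
  exact (PiLp.hasFDerivAt_toLp 2 (γ t).ofLp).comp_hasDerivAt t h

lemma spiralFlow_zero (x : Plane) : spiralFlow 0 x = x :=
  plane_ext (by simp [spiralFlow_apply_zero]) (by simp [spiralFlow_apply_one])

lemma shearFlow_zero (p : ℝ) (x : Plane) : shearFlow p 0 x = x :=
  plane_ext (by simp [shearFlow_apply_zero]) (by simp [shearFlow_apply_one])

lemma hasDerivAt_spiralFlow (e t : ℝ) (x : Plane) :
    HasDerivAt (fun s => Real.exp (-e * s) • spiralFlow s x)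
      (Matrix.toEuclideanCLM (n := Fin 2) (𝕜 := ℝ) (spiralMatrix e)
        (Real.exp (-e * t) • spiralFlow t x)) t := by
  have he : HasDerivAt (fun s => Real.exp (-e * s)) (-e * Real.exp (-e * t)) t := by
    have := ((hasDerivAt_id t).const_mul (-e)).exp
    simpa [mul_comm] using this
  have hn : HasDerivAt (fun s => Real.exp (-s)) (-Real.exp (-t)) t := by
    simpa using (hasDerivAt_id t).neg.exp
  have hc := Real.hasDerivAt_cos t
  have hs := Real.hasDerivAt_sin t
  refine hasDerivAt_plane ?_ ?_
  · rw [spiralMatrix_apply_zero]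
    simp only [PiLp.smul_apply, smul_eq_mul, spiralFlow_apply_zero, spiralFlow_apply_one]
    refine (he.fun_mul
      (hn.fun_mul ((hc.mul_const (x 0)).fun_sub (hs.mul_const (x 1))))).congr_deriv ?_
    ring
  · rw [spiralMatrix_apply_one]
    simp only [PiLp.smul_apply, smul_eq_mul, spiralFlow_apply_zero, spiralFlow_apply_one]
    refine (he.fun_mul
      (hn.fun_mul ((hs.mul_const (x 0)).fun_add (hc.mul_const (x 1))))).congr_deriv ?_
    ring

lemma hasDerivAt_shearFlow (p e t : ℝ) (x : Plane) :
    HasDerivAt (fun s => Real.exp (-e * s) • shearFlow p s x)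
      (Matrix.toEuclideanCLM (n := Fin 2) (𝕜 := ℝ) (shearMatrix p e)
        (Real.exp (-e * t) • shearFlow p t x)) t := by
  have he : HasDerivAt (fun s => Real.exp (-e * s)) (-e * Real.exp (-e * t)) t := by
    have := ((hasDerivAt_id t).const_mul (-e)).exp
    simpa [mul_comm] using this
  have hn : HasDerivAt (fun s => Real.exp (-s)) (-Real.exp (-t)) t := by
    simpa using (hasDerivAt_id t).neg.exp
  refine hasDerivAt_plane ?_ ?_
  · rw [shearMatrix_apply_zero]
    simp only [PiLp.smul_apply, smul_eq_mul, shearFlow_apply_zero, shearFlow_apply_one]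
    refine (he.fun_mul
      ((((hn.const_sub 1).const_mul p).mul_const (x 1)).const_add (x 0))).congr_deriv ?_
    ring
  · rw [shearMatrix_apply_one]
    simp only [PiLp.smul_apply, smul_eq_mul, shearFlow_apply_one]
    refine (he.fun_mul (hn.mul_const (x 1))).congr_deriv ?_
    ring

lemma spiralObs_spiralFlow (p t h : ℝ) (x : Plane) :
    spiralObs p t (spiralFlow h x) = spiralObs p (t + h) x := by
  simp only [spiralObs, spiralFlow_apply_zero, spiralFlow_apply_one, Real.cos_add, Real.sin_add,
    neg_add, Real.exp_add]
  ring

lemma spiralFlow_spiralFlow (s t : ℝ) (x : Plane) :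
    spiralFlow s (spiralFlow t x) = spiralFlow (s + t) x := by
  refine plane_ext ?_ ?_ <;>
  · simp only [spiralFlow_apply_zero, spiralFlow_apply_one, Real.cos_add, Real.sin_add,
      neg_add, Real.exp_add]
    ring

lemma spiralFlow_smul (t a : ℝ) (x : Plane) : spiralFlow t (a • x) = a • spiralFlow t x := by
  refine plane_ext ?_ ?_ <;>
  · simp only [spiralFlow_apply_zero, spiralFlow_apply_one, PiLp.smul_apply, smul_eq_mul]
    ring

lemma shearFlow_smul (p t a : ℝ) (x : Plane) : shearFlow p t (a • x) = a • shearFlow p t x := by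
  refine plane_ext ?_ ?_ <;>
  · simp only [shearFlow_apply_zero, shearFlow_apply_one, PiLp.smul_apply, smul_eq_mul]
    ring

lemma spiralObs_add (p t : ℝ) (x y : Plane) :
    spiralObs p t (x + y) = spiralObs p t x + spiralObs p t y := by
  simp only [spiralObs, PiLp.add_apply]
  ring

lemma spiralObs_smul (p t a : ℝ) (x : Plane) :
    spiralObs p t (a • x) = a * spiralObs p t x := by
  simp only [spiralObs, PiLp.smul_apply, smul_eq_mul]
  ring

lemma continuous_spiralObs (p : ℝ) (x : Plane) : Continuous fun t => spiralObs p t x := by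
  unfold spiralObs
  fun_prop

lemma spectrum_re_neg_of_quadratic {A : Matrix (Fin 2) (Fin 2) ℝ}
    (h : ∀ μ : ℂ, μ ^ 2 - (A 0 0 + A 1 1 : ℝ) * μ + (A 0 0 * A 1 1 - A 0 1 * A 1 0 : ℝ) = 0 →
      μ.re < 0) : IsHurwitz A := by
  intro μ hμ
  rw [Matrix.mem_spectrum_iff_isRoot_charpoly, Matrix.charpoly_fin_two] at hμ
  refine h μ ?_
  simpa [Matrix.trace_fin_two, Matrix.det_fin_two, Polynomial.IsRoot] using hμ

lemma isHurwitz_spiralMatrix {e : ℝ} (he : 0 < e) : IsHurwitz (spiralMatrix e) := by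
  refine spectrum_re_neg_of_quadratic fun μ hμ => ?_
  have h1 := congrArg Complex.re hμ
  have h2 := congrArg Complex.im hμ
  simp [spiralMatrix, pow_two, Complex.mul_re, Complex.mul_im] at h1 h2
  by_contra hcon
  push Not at hcon
  have h3 : (2 * (1 + e) + 2 * μ.re) * μ.im = 0 := by linarith
  have h4 : μ.im = 0 := by
    rcases mul_eq_zero.1 h3 with h | h
    · nlinarith
    · exact h
  rw [h4] at h1
  nlinarith [mul_nonneg hcon he.le, sq_nonneg μ.re]

lemma isHurwitz_shearMatrix (p : ℝ) {e : ℝ} (he : 0 < e) : IsHurwitz (shearMatrix p e) := by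
  refine spectrum_re_neg_of_quadratic fun μ hμ => ?_
  have h : (μ + e) * (μ + (1 + e)) = 0 := by
    rw [← hμ]
    simp [shearMatrix]
    ring
  rcases mul_eq_zero.1 h with h | h
  · rw [eq_neg_of_add_eq_zero_left h]
    simpa using he
  · rw [eq_neg_of_add_eq_zero_left h]
    simp
    linarith

/-! ### The critical slope -/

/-- For a suitable slope `p` the observable `t ↦ e^{-t} (cos t + p sin t)` stays in `[-1, 1]` at
nonnegative times and returns to absolute value `1` at a positive time. -/
lemma exists_critical_slope : ∃ p σ : ℝ, 0 < σ ∧ σ < Real.pi ∧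
    spiralObs p σ planeE = -1 ∧ ∀ t, 0 ≤ t → |spiralObs p t planeE| ≤ 1 := by
  -- For a suitable `p` the observable is `-k (t + τ)`. The curve `k` has a critical point at `0`
  -- with value `1`; going backwards from there, `τ` is a point of `(-π, 0)` where `k = -1`, and `σ
  -- = -τ`.
  set k : ℝ → ℝ := fun τ => Real.exp (-τ) * (Real.cos τ + Real.sin τ) with hk
  have hkd : ∀ τ, HasDerivAt k (-2 * (Real.exp (-τ) * Real.sin τ)) τ := by
    intro τ
    have hn : HasDerivAt (fun s => Real.exp (-s)) (-Real.exp (-τ)) τ := by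
      simpa using (hasDerivAt_id τ).neg.exp
    refine (hn.fun_mul ((Real.hasDerivAt_cos τ).fun_add (Real.hasDerivAt_sin τ))).congr_deriv ?_
    ring
  have hkc : Continuous k := by fun_prop
  have hmono : MonotoneOn k (Icc (-Real.pi) 0) := by
    refine monotoneOn_of_deriv_nonneg (convex_Icc _ _) hkc.continuousOn
      (fun x _ => (hkd x).differentiableAt.differentiableWithinAt) fun x hx => ?_
    rw [interior_Icc] at hx
    rw [(hkd x).deriv]
    have := Real.sin_nonpos_of_nonpos_of_neg_pi_le hx.2.le hx.1.le
    nlinarith [mul_nonneg (Real.exp_pos (-x)).le (neg_nonneg.2 this)]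
  have hk0 : k 0 = 1 := by simp [hk]
  have hkpi : k (-Real.pi) ≤ -1 := by
    simpa [hk] using Real.pi_pos.le
  obtain ⟨τ, hτ, hτk⟩ := intermediate_value_Icc (neg_nonpos.2 Real.pi_pos.le)
    hkc.continuousOn (show (-1 : ℝ) ∈ Icc (k (-Real.pi)) (k 0) from ⟨hkpi, by rw [hk0]; norm_num⟩)
  have hτ0 : τ < 0 := by
    refine lt_of_le_of_ne hτ.2 ?_
    rintro rfl
    rw [hk0] at hτk
    norm_num at hτk
  have hτpi : -Real.pi < τ := by
    refine lt_of_le_of_ne hτ.1 ?_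
    rintro rfl
    simp [hk, Real.pi_ne_zero] at hτk
  -- Monotonicity settles `[τ, 0]`. Afterwards `(cos s + sin s) ^ 2 = 1 + sin (2 * s) ≤ 1 + 2 * s ≤
  -- exp (2 * s)`.
  have hbound : ∀ s, τ ≤ s → |k s| ≤ 1 := by
    intro s hs
    rcases le_total s 0 with h | h
    · have h1 := hmono hτ ⟨hτ.1.trans hs, h⟩ hs
      have h2 := hmono ⟨hτ.1.trans hs, h⟩ ⟨by linarith [Real.pi_pos], le_rfl⟩ h
      rw [abs_le]
      constructor <;> linarith
    · refine abs_le_of_sq_le_sq ?_ zero_le_one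
      have h1 : (Real.cos s + Real.sin s) ^ 2 ≤ Real.exp (2 * s) := by
        have h2 := Real.sin_le (by linarith : 0 ≤ 2 * s)
        rw [Real.sin_two_mul] at h2
        nlinarith [Real.add_one_le_exp (2 * s), Real.sin_sq_add_cos_sq s]
      have h3 : Real.exp (-s) ^ 2 * Real.exp (2 * s) = 1 := by
        rw [← Real.exp_nat_mul, ← Real.exp_add]
        simp
      calc k s ^ 2 = Real.exp (-s) ^ 2 * (Real.cos s + Real.sin s) ^ 2 := by rw [hk]; ring
        _ ≤ Real.exp (-s) ^ 2 * Real.exp (2 * s) := by gcongr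
        _ = 1 ^ 2 := by rw [h3]; norm_num
  have hobs : ∀ t, spiralObs (-(Real.exp (-τ) * (Real.cos τ - Real.sin τ))) t planeE
      = -k (t + τ) := by
    intro t
    have h1 : Real.exp (-τ) * (Real.cos τ + Real.sin τ) = -1 := hτk
    simp only [spiralObs, planeE_zero, planeE_one, hk, Real.cos_add, Real.sin_add, neg_add,
      Real.exp_add]
    linear_combination (Real.exp (-t) * Real.cos t) * h1
  refine ⟨-(Real.exp (-τ) * (Real.cos τ - Real.sin τ)), -τ, by linarith, by linarith, ?_,
    fun t ht => ?_⟩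
  · rw [hobs, neg_add_cancel, hk0]
  · rw [hobs, abs_neg]
    exact hbound _ (by linarith)

/-! ### Power moments of the observable -/

lemma abs_spiralObs_le (p t : ℝ) (x : Plane) :
    |spiralObs p t x| ≤ (|x 0 + p * x 1| + |p * x 0 - x 1|) * Real.exp (-t) := by
  rw [spiralObs, abs_mul, abs_of_pos (Real.exp_pos _), mul_comm]
  gcongr
  refine (abs_add_le _ _).trans ?_
  rw [abs_mul, abs_mul]
  have h1 := mul_le_mul_of_nonneg_left (Real.abs_cos_le_one t) (abs_nonneg (x 0 + p * x 1))
  have h2 := mul_le_mul_of_nonneg_left (Real.abs_sin_le_one t) (abs_nonneg (p * x 0 - x 1))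
  linarith

lemma integrableOn_spiralObs_mul (p : ℝ) (x y : Plane) {i j : ℕ} (h : i + j ≠ 0) :
    IntegrableOn (fun t => spiralObs p t x ^ i * spiralObs p t y ^ j) (Ioi 0) := by
  have he : IntegrableOn (fun t : ℝ => Real.exp (-t)) (Ioi 0) := by
    simpa using exp_neg_integrableOn_Ioi 0 one_pos
  refine Integrable.mono' (he.const_mul ((|x 0 + p * x 1| + |p * x 0 - x 1|) ^ i *
    (|y 0 + p * y 1| + |p * y 0 - y 1|) ^ j)) ?_ ?_
  · exact (((continuous_spiralObs p x).pow i).mul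
      ((continuous_spiralObs p y).pow j)).aestronglyMeasurable
  · refine (ae_restrict_iff' measurableSet_Ioi).2 (Eventually.of_forall fun t ht => ?_)
    rw [Real.norm_eq_abs, abs_mul, abs_pow, abs_pow]
    have h1 : |spiralObs p t x| ^ i * |spiralObs p t y| ^ j ≤
        ((|x 0 + p * x 1| + |p * x 0 - x 1|) * Real.exp (-t)) ^ i *
        ((|y 0 + p * y 1| + |p * y 0 - y 1|) * Real.exp (-t)) ^ j := by
      gcongr <;> exact abs_spiralObs_le _ _ _
    refine h1.trans ?_
    have h2 : Real.exp (-t) ^ (i + j) ≤ Real.exp (-t) :=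
      pow_le_of_le_one (Real.exp_pos _).le (Real.exp_le_one_iff.2 (by simpa using ht.le)) h
    calc _ = (|x 0 + p * x 1| + |p * x 0 - x 1|) ^ i *
        (|y 0 + p * y 1| + |p * y 0 - y 1|) ^ j * Real.exp (-t) ^ (i + j) := by
          rw [mul_pow, mul_pow, pow_add]; ring
      _ ≤ _ := by gcongr

/-- The `n`-th power moment of the observable along the spiral flow. -/
noncomputable def spiralMoment (p : ℝ) (n : ℕ) (x : Plane) : ℝ :=
  ∫ t in Ioi (0 : ℝ), spiralObs p t x ^ n

lemma integrableOn_spiralObs_pow (p : ℝ) (x : Plane) {n : ℕ} (hn : n ≠ 0) :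
    IntegrableOn (fun t => spiralObs p t x ^ n) (Ioi 0) := by
  simpa using integrableOn_spiralObs_mul p x x (i := n) (j := 0) (by simpa using hn)

/-- The binary form that represents the moment. -/
noncomputable def spiralMomentPoly (p : ℝ) (n : ℕ) : MvPolynomial (Fin 2) ℝ :=
  ∑ k ∈ Finset.range (n + 1), MvPolynomial.C ((∫ t in Ioi (0 : ℝ),
    spiralObs p t !₂[1, 0] ^ k * spiralObs p t !₂[0, 1] ^ (n - k)) * (n.choose k)) *
    MvPolynomial.X 0 ^ k * MvPolynomial.X 1 ^ (n - k)

/-- The observable is linear in `x`, so the binomial theorem turns the moment into a binary form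
with mixed moments of the basis vectors as coefficients. -/
lemma spiralMoment_eq_sum (p : ℝ) {n : ℕ} (hn : n ≠ 0) (x : Plane) :
    spiralMoment p n x = ∑ k ∈ Finset.range (n + 1), ((∫ t in Ioi (0 : ℝ),
      spiralObs p t !₂[1, 0] ^ k * spiralObs p t !₂[0, 1] ^ (n - k)) * (n.choose k)) *
      x 0 ^ k * x 1 ^ (n - k) := by
  have h : ∀ t, spiralObs p t x ^ n = ∑ k ∈ Finset.range (n + 1),
      (spiralObs p t !₂[1, 0] ^ k * spiralObs p t !₂[0, 1] ^ (n - k)) *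
        ((n.choose k) * x 0 ^ k * x 1 ^ (n - k)) := by
    intro t
    have hx : spiralObs p t x = spiralObs p t !₂[1, 0] * x 0 + spiralObs p t !₂[0, 1] * x 1 := by
      simp [spiralObs]
      ring
    rw [hx, add_pow]
    refine Finset.sum_congr rfl fun k _ => ?_
    rw [mul_pow, mul_pow]
    ring
  simp only [spiralMoment, h]
  rw [integral_finsetSum]
  · refine Finset.sum_congr rfl fun k _ => ?_
    rw [integral_mul_const]
    ring
  · intro k hk
    refine (integrableOn_spiralObs_mul p _ _ ?_).mul_const _
    rw [Finset.mem_range] at hk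
    omega

lemma eval_spiralMomentPoly (p : ℝ) {n : ℕ} (hn : n ≠ 0) (x : Plane) :
    MvPolynomial.eval (fun i => x i) (spiralMomentPoly p n) = spiralMoment p n x := by
  simp [spiralMomentPoly, spiralMoment_eq_sum p hn]

lemma differentiable_spiralMoment (p : ℝ) {n : ℕ} (hn : n ≠ 0) :
    Differentiable ℝ (spiralMoment p n) := by
  have h : ∀ i : Fin 2, Differentiable ℝ fun x : Plane => x i := fun i x =>
    (PiLp.hasFDerivAt_apply 2 x i).differentiableAt
  have h0 := h 0
  have h1 := h 1
  rw [funext (spiralMoment_eq_sum p hn)]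
  fun_prop

lemma spiralMoment_smul (p : ℝ) (n : ℕ) (a : ℝ) (x : Plane) :
    spiralMoment p n (a • x) = a ^ n * spiralMoment p n x := by
  simp only [spiralMoment, spiralObs_smul, mul_pow, integral_const_mul]

/-- Flowing for time `h` shifts the integrand, which cuts the domain down to `(h, ∞)`; an even power
is nonnegative. -/
lemma spiralMoment_spiralFlow_le (p : ℝ) {m : ℕ} (hm : m ≠ 0) {h : ℝ} (hh : 0 ≤ h) (x : Plane) :
    spiralMoment p (2 * m) (spiralFlow h x) ≤ spiralMoment p (2 * m) x := by
  simp only [spiralMoment, spiralObs_spiralFlow]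
  have h1 := (measurePreserving_add_right (volume : Measure ℝ) h).setIntegral_preimage_emb
    (MeasurableEquiv.addRight h).measurableEmbedding
    (fun t => spiralObs p t x ^ (2 * m)) (Ioi h)
  have h2 : (fun t : ℝ => t + h) ⁻¹' Ioi h = Ioi 0 := by
    ext t
    simp
  rw [h2] at h1
  rw [h1]
  exact setIntegral_mono_set (integrableOn_spiralObs_pow p x (by omega))
    (Eventually.of_forall fun t => (even_two_mul m).pow_nonneg _)
    (Eventually.of_forall (Ioi_subset_Ioi hh))

lemma spiralMoment_convex (p : ℝ) {m : ℕ} (hm : m ≠ 0) (x y : Plane) {a : ℝ}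
    (ha : a ∈ Icc (0 : ℝ) 1) :
    spiralMoment p (2 * m) ((1 - a) • x + a • y) ≤
      (1 - a) * spiralMoment p (2 * m) x + a * spiralMoment p (2 * m) y := by
  have hx := integrableOn_spiralObs_pow p x (n := 2 * m) (by omega)
  have hy := integrableOn_spiralObs_pow p y (n := 2 * m) (by omega)
  simp only [spiralMoment]
  rw [← integral_const_mul, ← integral_const_mul, ← integral_add (hx.const_mul _) (hy.const_mul _)]
  refine integral_mono (integrableOn_spiralObs_pow p _ (by omega))
    ((hx.const_mul _).add (hy.const_mul _)) fun t => ?_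
  simp only [spiralObs_add, spiralObs_smul]
  exact (even_two_mul m).convexOn_pow.2 (mem_univ _) (mem_univ _) (sub_nonneg.2 ha.2) ha.1
    (by ring)

lemma spiralMoment_ge (p : ℝ) {m : ℕ} (hm : m ≠ 0) (x : Plane) {a l c : ℝ} (ha : 0 ≤ a)
    (hl : 0 ≤ l) (hc : 0 ≤ c) (h : ∀ t ∈ Ioc a (a + l), c ≤ |spiralObs p t x|) :
    l * c ^ (2 * m) ≤ spiralMoment p (2 * m) x := by
  have hi := integrableOn_spiralObs_pow p x (n := 2 * m) (by omega)
  have hs : Ioc a (a + l) ⊆ Ioi 0 := fun t ht => ha.trans_lt ht.1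
  calc l * c ^ (2 * m) = ∫ _ in Ioc a (a + l), c ^ (2 * m) := by
        simp [hl]
    _ ≤ ∫ t in Ioc a (a + l), spiralObs p t x ^ (2 * m) := by
        refine setIntegral_mono_on (by simp) (hi.mono_set hs) measurableSet_Ioc
          fun t ht => ?_
        rw [← (even_two_mul m).pow_abs (spiralObs p t x)]
        gcongr
        exact h t ht
    _ ≤ _ := setIntegral_mono_set hi
        (Eventually.of_forall fun t => (even_two_mul m).pow_nonneg _) (Eventually.of_forall hs)

lemma abs_spiralObs_ge (p t : ℝ) (x : Plane) :
    Real.exp (-t) * (|p * x 0 - x 1| * |Real.sin t| - |x 0 + p * x 1| * |Real.cos t|) ≤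
      |spiralObs p t x| ∧
    Real.exp (-t) * (|x 0 + p * x 1| * |Real.cos t| - |p * x 0 - x 1| * |Real.sin t|) ≤
      |spiralObs p t x| := by
  rw [spiralObs, abs_mul, abs_of_pos (Real.exp_pos _), ← abs_mul, ← abs_mul]
  have h : ∀ a b : ℝ, |a| - |b| ≤ |a + b| := fun a b => by
    simpa using abs_sub_abs_le_abs_sub a (-b)
  constructor <;> gcongr
  · exact (h _ _).trans_eq (by rw [add_comm])
  · exact h _ _

/-- The sine term dominates on the window `(1, 2]`, where `sin t ≥ 1 / 2` and `exp (-t) ≥ 1 / 9`. -/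
lemma spiralMoment_ge_of_large (p : ℝ) {m : ℕ} (hm : m ≠ 0) (x : Plane)
    (h : 2 * |x 0 + p * x 1| ≤ |p * x 0 - x 1|) :
    ((|p * x 0 - x 1| / 2 - |x 0 + p * x 1|) / 9) ^ (2 * m) ≤ spiralMoment p (2 * m) x := by
  have := spiralMoment_ge p hm x (a := 1) (l := 1)
    (c := (|p * x 0 - x 1| / 2 - |x 0 + p * x 1|) / 9) zero_le_one zero_le_one (by linarith)
    (fun t ht => by
      refine le_trans ?_ (abs_spiralObs_ge p t x).1
      have h1 : 1 / 2 ≤ Real.sin t := by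
        rw [← Real.cos_sub_pi_div_two]
        have := Real.one_sub_sq_div_two_le_cos (x := t - Real.pi / 2)
        nlinarith [Real.pi_gt_d2, Real.pi_lt_d2, ht.1, ht.2]
      have h2 : 1 / 9 ≤ Real.exp (-t) := by
        have h3 : Real.exp (-2) ≤ Real.exp (-t) := Real.exp_le_exp.2 (by linarith [ht.2])
        refine le_trans ?_ h3
        rw [Real.exp_neg, one_div]
        refine inv_anti₀ (Real.exp_pos _) ?_
        have : Real.exp 2 = Real.exp 1 ^ 2 := by rw [← Real.exp_nat_mul]; norm_num
        rw [this]
        nlinarith [Real.exp_one_lt_d9, Real.exp_pos 1]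
      have h3 : |p * x 0 - x 1| / 2 - |x 0 + p * x 1| ≤
          |p * x 0 - x 1| * |Real.sin t| - |x 0 + p * x 1| * |Real.cos t| := by
        have h4 := mul_le_mul_of_nonneg_left (h1.trans (le_abs_self _)) (abs_nonneg (p * x 0 - x 1))
        have h5 := mul_le_mul_of_nonneg_left (Real.abs_cos_le_one t) (abs_nonneg (x 0 + p * x 1))
        linarith
      calc (|p * x 0 - x 1| / 2 - |x 0 + p * x 1|) / 9
          = 1 / 9 * (|p * x 0 - x 1| / 2 - |x 0 + p * x 1|) := by ring
        _ ≤ _ := mul_le_mul h2 h3 (by linarith) (Real.exp_pos _).le)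
  simpa using this

/-- Lower bound for the moment in terms of the value of the observable at time `0`. -/
lemma spiralMoment_ge_obs (p : ℝ) {m : ℕ} (hm : m ≠ 0) (x : Plane) {δ : ℝ} (hδ : 0 < δ)
    (hδ' : δ ≤ 1 / 44) :
    δ * ((1 - 22 * δ) * |x 0 + p * x 1|) ^ (2 * m) ≤ spiralMoment p (2 * m) x := by
  have hP := abs_nonneg (x 0 + p * x 1)
  -- If the sine coefficient is moderate, the observable loses at most the factor `(1 - t) * (1 - 21
  -- * t) ≥ 1 - 22 * t` on a short window. Otherwise the window `(1, 2]` suffices, since `(20 / 2 -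
  -- 1) / 9 = 1`.
  rcases le_total (|p * x 0 - x 1|) (20 * |x 0 + p * x 1|) with h | h
  · refine spiralMoment_ge p hm x le_rfl hδ.le (mul_nonneg (by linarith) hP) fun t ht => ?_
    refine le_trans ?_ (abs_spiralObs_ge p t x).2
    rw [zero_add] at ht
    have h1 : 1 - t ≤ Real.exp (-t) := by linarith [Real.add_one_le_exp (-t)]
    have h2 : 1 - t ≤ |Real.cos t| := by
      refine le_trans ?_ (le_abs_self _)
      nlinarith [Real.one_sub_sq_div_two_le_cos (x := t), ht.1, ht.2]
    have h3 : |Real.sin t| ≤ t := (Real.abs_sin_le_abs).trans (abs_of_pos ht.1).le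
    have h4 : |x 0 + p * x 1| * (1 - 21 * t) ≤
        |x 0 + p * x 1| * |Real.cos t| - |p * x 0 - x 1| * |Real.sin t| := by
      have h5 := mul_le_mul_of_nonneg_left h2 hP
      have h6 := mul_le_mul h h3 (abs_nonneg _) (by positivity)
      linarith
    calc (1 - 22 * δ) * |x 0 + p * x 1| ≤ (1 - t) * (|x 0 + p * x 1| * (1 - 21 * t)) := by
          have : 1 - 22 * δ ≤ (1 - t) * (1 - 21 * t) := by nlinarith [ht.1, ht.2]
          nlinarith
      _ ≤ _ := mul_le_mul h1 h4 (mul_nonneg hP (by linarith [ht.2])) (Real.exp_pos _).le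
  · refine le_trans ?_ (spiralMoment_ge_of_large p hm x (by linarith))
    calc δ * ((1 - 22 * δ) * |x 0 + p * x 1|) ^ (2 * m)
        ≤ 1 * (1 * |x 0 + p * x 1|) ^ (2 * m) := by
          exact mul_le_mul (by linarith) (pow_le_pow_left₀ (mul_nonneg (by linarith) hP)
            (mul_le_mul_of_nonneg_right (by linarith) hP) _)
            ((even_two_mul m).pow_nonneg _) zero_le_one
      _ ≤ _ := by
          rw [one_mul, one_mul]
          gcongr
          linarith

lemma spiralMoment_pos (p : ℝ) {m : ℕ} (hm : m ≠ 0) {x : Plane} (hx : x ≠ 0) :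
    0 < spiralMoment p (2 * m) x := by
  rcases eq_or_ne (x 0 + p * x 1) 0 with h | h
  · have hQ : p * x 0 - x 1 ≠ 0 := by
      intro hQ
      have h1 : (1 + p ^ 2) * x 1 = 0 := by linear_combination p * h - hQ
      have h2 : x 1 = 0 := (mul_eq_zero.1 h1).resolve_left (by positivity)
      have h3 : x 0 = 0 := by simpa [h2] using h
      exact hx (plane_ext h3 h2)
    refine lt_of_lt_of_le ?_ (spiralMoment_ge_of_large p hm x (by simp [h]))
    rw [h]
    have := abs_pos.2 hQ
    simp only [abs_zero, sub_zero]
    positivity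
  · refine lt_of_lt_of_le ?_ (spiralMoment_ge_obs p hm x (δ := 1 / 44) (by norm_num) le_rfl)
    have := abs_pos.2 h
    norm_num
    positivity

/-- The bound is independent of `m`, so `m` can later be chosen large against it. -/
lemma spiralMoment_planeE_le {p : ℝ} (hp : ∀ t, 0 ≤ t → |spiralObs p t planeE| ≤ 1) {m : ℕ}
    (hm : m ≠ 0) : spiralMoment p (2 * m) planeE ≤ spiralMoment p 2 planeE := by
  refine setIntegral_mono_on (integrableOn_spiralObs_pow p _ (by omega))
    (integrableOn_spiralObs_pow p _ two_ne_zero) measurableSet_Ioi fun t ht => ?_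
  rw [pow_mul]
  refine pow_le_of_le_one (sq_nonneg _) ?_ hm
  rw [sq_le_one_iff_abs_le_one]
  exact hp t (le_of_lt ht)

/-! ### Polynomial common Lyapunov functions -/

lemma HasDerivAt.le_of_le_linear {g : ℝ → ℝ} {g' C : ℝ} (hg : HasDerivAt g g' 0)
    (h : ∀ s ∈ Ioc (0 : ℝ) 1, g s ≤ g 0 + C * s) : g' ≤ C := by
  have h1 := hg.tendsto_slope.mono_left (nhdsWithin_mono (0 : ℝ) (s := Ioi 0)
    (fun x hx => (ne_of_gt hx : x ≠ 0)))
  refine le_of_tendsto h1 ?_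
  filter_upwards [Ioc_mem_nhdsGT (zero_lt_one' ℝ)] with s hs
  rw [slope_def_field, sub_zero, div_le_iff₀ hs.1]
  linarith [h s hs]

/-- Existence of a polynomial common Lyapunov function, with a decay estimate. -/
lemma exists_form_lyapunov {p : ℝ} (hp : ∀ t, 0 ≤ t → |spiralObs p t planeE| ≤ 1) {e : ℝ}
    (he : 0 < e) : ∃ (n : ℕ) (V' : Plane → Plane →L[ℝ] ℝ) (k : ℝ), n ≠ 0 ∧ 0 < k ∧
      (∀ x, HasFDerivAt (spiralMoment p n) (V' x) x) ∧
      (∀ x, x ≠ 0 → 0 < spiralMoment p n x) ∧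
      (∀ x, V' x (Matrix.toEuclideanCLM (n := Fin 2) (𝕜 := ℝ) (spiralMatrix e) x) ≤
        -k * spiralMoment p n x) ∧
      (∀ x, V' x (Matrix.toEuclideanCLM (n := Fin 2) (𝕜 := ℝ) (shearMatrix p e) x) ≤
        -k * spiralMoment p n x) := by
  -- The factor `l` spends half of the damping, as `l⁻¹ - 1 = e / 2`. The choice of `δ` below makes
  -- `1 - 22 * δ = (1 + l) / 2 > l`, so a high power of the ratio beats the constants.
  set l : ℝ := (1 + e / 2)⁻¹ with hl
  have hl0 : 0 < l := by positivity
  have hl1 : l < 1 := inv_lt_one_of_one_lt₀ (by linarith)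
  set δ : ℝ := (1 - l) / 44 with hδ
  set C := spiralMoment p 2 planeE with hC
  have hC0 : 0 ≤ C := integral_nonneg fun t => sq_nonneg _
  obtain ⟨j, hj⟩ := exists_pow_lt_of_lt_one (y := l / ((1 + l) / 2))
    (show 0 < δ / (C + 1) from div_pos (by rw [hδ]; linarith) (by linarith))
    (by rw [div_lt_one (by linarith)]; linarith)
  set m := j + 1 with hm'
  have hm : m ≠ 0 := by omega
  have hsmall : l ^ (2 * m) * C ≤ δ * ((1 + l) / 2) ^ (2 * m) := by
    have h1 : (l / ((1 + l) / 2)) ^ (2 * m) ≤ δ / (C + 1) := by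
      refine le_trans (pow_le_pow_of_le_one (by positivity) ?_ (by omega)) hj.le
      rw [div_le_one (by linarith)]
      linarith
    rw [div_pow, div_le_div_iff₀ (by positivity) (by linarith)] at h1
    nlinarith [pow_pos hl0 (2 * m)]
  set V := spiralMoment p (2 * m) with hVdef
  have hdiff : ∀ x, HasFDerivAt V (fderiv ℝ V x) x := fun x =>
    (differentiable_spiralMoment p (by omega) x).hasFDerivAt
  have hcurve : ∀ {γ : ℝ → Plane} {v x : Plane}, HasDerivAt γ v 0 → γ 0 = x →
      HasDerivAt (fun s => V (γ s)) (fderiv ℝ V x v) 0 := by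
    intro γ v x hγ hx
    subst hx
    exact (hdiff (γ 0)).comp_hasDerivAt 0 hγ
  have heuler : ∀ x, fderiv ℝ V x x = (2 * m : ℕ) * V x := by
    intro x
    have h1 : HasDerivAt (fun s : ℝ => (1 + s) • x) x 0 := by
      simpa using ((hasDerivAt_id (0 : ℝ)).const_add 1).smul_const x
    have h2 := hcurve (x := x) h1 (by simp)
    have h3 : (fun s : ℝ => V ((1 + s) • x)) = fun s => (1 + s) ^ (2 * m) * V x :=
      funext fun s => spiralMoment_smul p _ _ _
    have h4 : HasDerivAt (fun s : ℝ => (1 + s) ^ (2 * m) * V x) ((2 * m : ℕ) * V x) 0 := by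
      simpa using (((hasDerivAt_id (0 : ℝ)).const_add 1).fun_pow (2 * m)).mul_const (V x)
    rw [h3] at h2
    exact h2.unique h4
  have hspiral : ∀ x, fderiv ℝ V x
      (Matrix.toEuclideanCLM (n := Fin 2) (𝕜 := ℝ) (spiralMatrix 0) x) ≤ 0 := by
    intro x
    have h1 := hasDerivAt_spiralFlow 0 0 x
    simp only [neg_zero, zero_mul, Real.exp_zero, one_smul, spiralFlow_zero] at h1
    refine (hcurve h1 (spiralFlow_zero x)).le_of_le_linear fun s hs => ?_
    rw [spiralFlow_zero, zero_mul, add_zero]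
    exact spiralMoment_spiralFlow_le p hm hs.1.le x
  -- The shear's limit point on the axis, shrunk by `l`, lies in the sublevel set of `x`. For the
  -- supremum in place of the moment this would hold with `l = 1`.
  have hproj : ∀ x : Plane, V ((l * (x 0 + p * x 1)) • planeE) ≤ V x := by
    intro x
    rw [hVdef, spiralMoment_smul, mul_pow]
    refine le_trans ?_ (spiralMoment_ge_obs p hm x (δ := δ) (by rw [hδ]; linarith)
      (by rw [hδ]; linarith))
    have h1 : 1 - 22 * δ = (1 + l) / 2 := by rw [hδ]; ring
    rw [h1, mul_pow, (even_two_mul m).pow_abs]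
    have h2 := spiralMoment_planeE_le hp hm
    have h3 : 0 ≤ (x 0 + p * x 1) ^ (2 * m) := (even_two_mul m).pow_nonneg _
    calc _ = (x 0 + p * x 1) ^ (2 * m) * (l ^ (2 * m) * spiralMoment p (2 * m) planeE) := by ring
      _ ≤ (x 0 + p * x 1) ^ (2 * m) * (l ^ (2 * m) * C) := by gcongr
      _ ≤ (x 0 + p * x 1) ^ (2 * m) * (δ * ((1 + l) / 2) ^ (2 * m)) := by gcongr
      _ = _ := by ring
  have hconv : ∀ x y, V y ≤ V x → fderiv ℝ V x (y - x) ≤ 0 := by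
    intro x y hxy
    have h1 : HasDerivAt (fun s : ℝ => (1 - s) • x + s • y) (y - x) 0 := by
      have := (((hasDerivAt_id (0 : ℝ)).const_sub 1).smul_const x).add
        ((hasDerivAt_id (0 : ℝ)).smul_const y)
      refine this.congr_deriv ?_
      simp [sub_eq_neg_add]
    refine (hcurve h1 (by simp)).le_of_le_linear fun s hs => ?_
    refine (spiralMoment_convex p hm x y ⟨hs.1.le, hs.2⟩).trans ?_
    simp only [sub_zero, one_smul, zero_smul, add_zero, zero_mul]
    nlinarith [hs.1]
  have hnn : ∀ x, 0 ≤ V x := fun x => integral_nonneg fun t => (even_two_mul m).pow_nonneg _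
  have hmpos : (0 : ℝ) < (2 * m : ℕ) := by exact_mod_cast (by omega : 0 < 2 * m)
  refine ⟨2 * m, fun x => fderiv ℝ V x, e / 2 * (2 * m : ℕ), by omega, by positivity, hdiff,
    fun x hx => spiralMoment_pos p hm hx, fun x => ?_, fun x => ?_⟩
  · have h1 : Matrix.toEuclideanCLM (n := Fin 2) (𝕜 := ℝ) (spiralMatrix e) x =
        Matrix.toEuclideanCLM (n := Fin 2) (𝕜 := ℝ) (spiralMatrix 0) x - e • x := by
      refine plane_ext ?_ ?_ <;>
      · simp only [PiLp.sub_apply, PiLp.smul_apply, smul_eq_mul, spiralMatrix_apply_zero,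
          spiralMatrix_apply_one]
        ring
    rw [h1, map_sub, map_smul, smul_eq_mul, heuler]
    have h2 := hspiral x
    have h3 : 0 ≤ e / 2 * ((2 * m : ℕ) * V x) := by have := hnn x; positivity
    linarith
  -- The undamped shear field at `x` points from `x` to its limit point. Aiming at the shrunk point
  -- instead lets convexity apply; the remaining radial term has coefficient `-e / 2`, which Euler's
  -- identity turns into decay.
  · have h1 : Matrix.toEuclideanCLM (n := Fin 2) (𝕜 := ℝ) (shearMatrix p e) x =
        l⁻¹ • ((l * (x 0 + p * x 1)) • planeE - x) + (l⁻¹ - 1 - e) • x := by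
      refine plane_ext ?_ ?_ <;>
      · simp only [PiLp.sub_apply, PiLp.add_apply, PiLp.smul_apply, smul_eq_mul,
          shearMatrix_apply_zero, shearMatrix_apply_one, planeE_zero, planeE_one]
        field_simp
        ring
    have h2 := hconv x _ (hproj x)
    have h3 : l⁻¹ = 1 + e / 2 := by rw [hl, inv_inv]
    rw [h1, map_add, map_smul, map_smul, smul_eq_mul, smul_eq_mul, heuler]
    have h4 : l⁻¹ * fderiv ℝ V x ((l * (x 0 + p * x 1)) • planeE - x) ≤ 0 :=
      mul_nonpos_of_nonneg_of_nonpos (inv_nonneg.2 hl0.le) h2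
    rw [h3] at h4 ⊢
    linarith

/-- A polynomial, as a piecewise-polynomial function with a single cone. -/
noncomputable def PPF.ofPoly {n : ℕ} (P : MvPolynomial (Fin n) ℝ) : PPF n where
  toFun x := MvPolynomial.eval (fun i => x i) P
  continuous := (MvPolynomial.continuous_eval P).comp (by fun_prop)
  numCones := 1
  cone _ := univ
  isCone _ _ _ _ _ := mem_univ _
  disjoint i j hij := absurd (Subsingleton.elim i j) hij
  cover := iUnion_const univ
  poly _ := P
  eq_poly _ _ _ := rfl

lemma mem_xiGUES_and_nonempty {U : Set ℝ} (hU : U ⊆ Icc 0 1) {p : ℝ}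
    (hp : ∀ t, 0 ≤ t → |spiralObs p t planeE| ≤ 1) {e : ℝ} (he : 0 < e) :
    (spiralMatrix e, shearMatrix p e) ∈ xiGUES U ∧
      (ppfCLFDegrees U (spiralMatrix e) (shearMatrix p e)).Nonempty := by
  obtain ⟨n, V', k, hn, hk, hV, hpos, hA, hB⟩ := exists_form_lyapunov hp he
  refine ⟨⟨isHurwitz_spiralMatrix he, isHurwitz_shearMatrix p he,
    isGUES_of_hasFDerivAt hU hV hpos hn (spiralMoment_smul p n) hk hA hB⟩, ?_⟩
  refine ⟨_, PPF.ofPoly (spiralMomentPoly p n), ?_, rfl⟩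
  have : (PPF.ofPoly (spiralMomentPoly p n)).toFun = spiralMoment p n :=
    funext (eval_spiralMomentPoly p hn)
  rw [this]
  refine isCLF_of_hasFDerivAt hU hV ?_ hpos hk hA hB
  simpa [zero_pow hn] using spiralMoment_smul p n 0 0

/-! ### Nearly closed trajectories and the squeeze -/

lemma isTrajectory_of_hasDerivAt {U : Set ℝ} {A B : Matrix (Fin 2) (Fin 2) ℝ} {a : ℝ}
    (ha : a ∈ U) {γ : ℝ → Plane} (h : ∀ t, HasDerivAt γ
      (Matrix.toEuclideanCLM (n := Fin 2) (𝕜 := ℝ) (a • A + (1 - a) • B) (γ t)) t) :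
    IsTrajectory U A B γ := by
  have hc : Continuous γ := continuous_iff_continuousAt.2 fun t => (h t).continuousAt
  refine ⟨fun _ => a, measurable_const, fun _ _ => ha, hc.continuousOn, fun t _ => ?_⟩
  rw [intervalIntegral.integral_eq_sub_of_hasDerivAt (fun s _ => h s)
    (((ContinuousLinearMap.continuous _).comp hc).intervalIntegrable _ _)]
  abel

lemma IsCLF.le_of_isTrajectory {U : Set ℝ} {A B : Matrix (Fin 2) (Fin 2) ℝ} {V : Plane → ℝ}
    (hV : IsCLF U A B V) {γ : ℝ → Plane} (hγ : IsTrajectory U A B γ) {t : ℝ} (ht : 0 ≤ t) :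
    V (γ t) ≤ V (γ 0) := by
  by_cases h : ∃ t, 0 ≤ t ∧ γ t ≠ γ 0
  · exact (hV.strictAnti γ hγ h).antitoneOn (mem_Ici.2 le_rfl) ht ht
  · push Not at h
    rw [h t ht]

lemma IsCLF.spiralFlow_le {U : Set ℝ} (h1 : (1 : ℝ) ∈ U) {p e : ℝ} {V : Plane → ℝ}
    (hV : IsCLF U (spiralMatrix e) (shearMatrix p e) V) {t : ℝ} (ht : 0 ≤ t) (x : Plane) :
    V (Real.exp (-e * t) • spiralFlow t x) ≤ V x := by
  have h := hV.le_of_isTrajectory (isTrajectory_of_hasDerivAt h1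
    (γ := fun s => Real.exp (-e * s) • spiralFlow s x)
    (fun s => by simpa using hasDerivAt_spiralFlow e s x)) ht
  simpa [spiralFlow_zero] using h

lemma IsCLF.shearFlow_le {U : Set ℝ} (h0 : (0 : ℝ) ∈ U) {p e : ℝ} {V : Plane → ℝ}
    (hV : IsCLF U (spiralMatrix e) (shearMatrix p e) V) {t : ℝ} (ht : 0 ≤ t) (x : Plane) :
    V (Real.exp (-e * t) • shearFlow p t x) ≤ V x := by
  have h := hV.le_of_isTrajectory (isTrajectory_of_hasDerivAt h0
    (γ := fun s => Real.exp (-e * s) • shearFlow p s x)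
    (fun s => by simpa using hasDerivAt_shearFlow p e s x)) ht
  simpa [shearFlow_zero] using h

/-- Following the spiral up to time `σ`, then the shear, then the spiral again leads back to the
opposite ray. -/
lemma spiralFlow_shearFlow_spiralFlow {p σ : ℝ} (hσ : spiralObs p σ planeE = -1) {T y : ℝ}
    (hy : y = Real.exp (-T) * (Real.exp (-σ) * Real.sin σ)) (hX : 0 < 1 + p * y) :
    spiralFlow (Real.arctan (y / (1 + p * y))) (shearFlow p T (spiralFlow σ planeE)) =
      (-(Real.exp (-Real.arctan (y / (1 + p * y))) *
        (Real.cos (Real.arctan (y / (1 + p * y))) * (1 + p * y) +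
          Real.sin (Real.arctan (y / (1 + p * y))) * y))) • planeE := by
  set η := Real.arctan (y / (1 + p * y)) with hη
  have hx1 : shearFlow p T (spiralFlow σ planeE) 1 = y := by
    rw [shearFlow_apply_one, spiralFlow_apply_one, hy]
    simp
  -- The shear stays on the line `x 0 + p * x 1 = -1`. The point is then at angle `η` from the
  -- negative axis, and the final spiral rotates by that angle.
  have hx0 : shearFlow p T (spiralFlow σ planeE) 0 = -(1 + p * y) := by
    rw [shearFlow_apply_zero, spiralFlow_apply_zero, spiralFlow_apply_one, hy]
    simp only [spiralObs, planeE_zero, planeE_one] at hσ ⊢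
    linear_combination hσ
  have hcos : 0 < Real.cos η := Real.cos_arctan_pos _
  have htan : Real.sin η * (1 + p * y) = Real.cos η * y := by
    have h := Real.tan_arctan (y / (1 + p * y))
    rw [← hη, Real.tan_eq_sin_div_cos, div_eq_div_iff hcos.ne' hX.ne'] at h
    linarith
  refine plane_ext ?_ ?_
  · rw [spiralFlow_apply_zero, hx0, hx1]
    simp only [PiLp.smul_apply, smul_eq_mul, planeE_zero]
    ring
  · rw [spiralFlow_apply_one, hx0, hx1]
    simp only [PiLp.smul_apply, smul_eq_mul, planeE_one]
    linear_combination -Real.exp (-η) * htan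

/-- Damping only multiplies the linear flows by scalars, so the undamped half turn survives up to
one accumulated factor. -/
lemma IsCLF.half_turn_le {U : Set ℝ} (h0 : (0 : ℝ) ∈ U) (h1 : (1 : ℝ) ∈ U) {p e : ℝ}
    {V : Plane → ℝ} (hV : IsCLF U (spiralMatrix e) (shearMatrix p e) V) {σ T η r : ℝ}
    (hT : 0 ≤ T) (hη : 0 ≤ η)
    (hret : spiralFlow η (shearFlow p T (spiralFlow σ planeE)) = (-r) • planeE)
    (s : ℝ) {t : ℝ} (ht : t ≤ σ) :
    V ((-(Real.exp (-e * (σ + T + η)) * r * s)) • planeE) ≤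
      V ((s * Real.exp (-e * t)) • spiralFlow t planeE) := by
  have a1 := hV.spiralFlow_le h1 (sub_nonneg.2 ht) ((s * Real.exp (-e * t)) • spiralFlow t planeE)
  rw [spiralFlow_smul, spiralFlow_spiralFlow, sub_add_cancel, smul_smul] at a1
  have a2 := hV.shearFlow_le h0 hT
    ((Real.exp (-e * (σ - t)) * (s * Real.exp (-e * t))) • spiralFlow σ planeE)
  rw [shearFlow_smul, smul_smul] at a2
  have a3 := hV.spiralFlow_le h1 hη ((Real.exp (-e * T) *
    (Real.exp (-e * (σ - t)) * (s * Real.exp (-e * t)))) •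
      shearFlow p T (spiralFlow σ planeE))
  rw [spiralFlow_smul, smul_smul, hret, smul_smul] at a3
  refine le_trans (le_of_eq ?_) (a3.trans (a2.trans a1))
  congr 2
  have h : Real.exp (-e * (σ + T + η)) = Real.exp (-e * η) * (Real.exp (-e * T) *
      (Real.exp (-e * (σ - t)) * Real.exp (-e * t))) := by
    rw [← Real.exp_add, ← Real.exp_add, ← Real.exp_add]
    congr 1
    ring
  rw [h]
  ring

/-- As the damping tends to zero, trajectories nearly close up, so that the values of a common
Lyapunov function on a spiral arc are squeezed between two values on a fixed ray. -/
lemma exists_squeeze {U : Set ℝ} (h0 : (0 : ℝ) ∈ U) (h1 : (1 : ℝ) ∈ U) {p σ : ℝ} (hσ0 : 0 < σ)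
    (hσpi : σ < Real.pi) (hσ : spiralObs p σ planeE = -1) :
    ∃ e κ : ℕ → ℝ, (∀ n, 0 < e n) ∧ Tendsto e atTop (𝓝 0) ∧ Tendsto κ atTop (𝓝 1) ∧
      ∀ᶠ n in atTop, ∀ V : Plane → ℝ, IsCLF U (spiralMatrix (e n)) (shearMatrix p (e n)) V →
        ∀ s t : ℝ, 0 ≤ t → t ≤ σ →
          V ((κ n * s) • planeE) ≤ V ((s * Real.exp (-e n * t)) • spiralFlow t planeE) ∧
          V ((s * Real.exp (-e n * t)) • spiralFlow t planeE) ≤ V (s • planeE) := by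
  set y : ℕ → ℝ := fun n => Real.exp (-(n : ℝ)) * (Real.exp (-σ) * Real.sin σ) with hy
  set η : ℕ → ℝ := fun n => Real.arctan (y n / (1 + p * y n)) with hη
  set r : ℕ → ℝ := fun n => Real.exp (-η n) *
    (Real.cos (η n) * (1 + p * y n) + Real.sin (η n) * y n) with hr
  -- The shear runs for time `n`, long enough that `y n → 0`, while `e n * n → 0` keeps the total
  -- damping negligible.
  set e : ℕ → ℝ := fun n => (1 / ((n : ℝ) + 1)) ^ 2 with he
  -- The square accounts for two half turns: `V` need not be even, so the comparison must return to
  -- the original ray.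
  set κ : ℕ → ℝ := fun n => (Real.exp (-e n * (σ + n + η n)) * r n) ^ 2 with hκ
  have hinv : Tendsto (fun n : ℕ => 1 / ((n : ℝ) + 1)) atTop (𝓝 0) :=
    tendsto_one_div_add_atTop_nhds_zero_nat
  have he0 : Tendsto e atTop (𝓝 0) := by
    have h : Tendsto e atTop (𝓝 (0 ^ 2)) := hinv.pow 2
    simpa using h
  have hy0 : Tendsto y atTop (𝓝 0) := by
    have : Tendsto (fun n : ℕ => Real.exp (-(n : ℝ))) atTop (𝓝 0) :=
      Real.tendsto_exp_neg_atTop_nhds_zero.comp tendsto_natCast_atTop_atTop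
    simpa using this.mul_const (Real.exp (-σ) * Real.sin σ)
  have hX : Tendsto (fun n => 1 + p * y n) atTop (𝓝 1) := by
    simpa using (hy0.const_mul p).const_add 1
  have hη0 : Tendsto η atTop (𝓝 0) := by
    have h : Tendsto η atTop (𝓝 (Real.arctan (0 / 1))) :=
      (Real.continuous_arctan.tendsto (0 / 1)).comp (hy0.div hX one_ne_zero)
    simpa using h
  have hr1 : Tendsto r atTop (𝓝 1) := by
    have hcont : Continuous fun q : ℝ × ℝ × ℝ => Real.exp (-q.1) *
        (Real.cos q.1 * q.2.1 + Real.sin q.1 * q.2.2) := by fun_prop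
    have h : Tendsto r atTop (𝓝 (Real.exp (-0) * (Real.cos 0 * 1 + Real.sin 0 * 0))) :=
      (hcont.tendsto (0, 1, 0)).comp (hη0.prodMk_nhds (hX.prodMk_nhds hy0))
    simpa using h
  have hen : Tendsto (fun n : ℕ => e n * (σ + n + η n)) atTop (𝓝 0) := by
    have h2 : Tendsto (fun n : ℕ => e n * (σ - 1 + η n) + 1 / ((n : ℝ) + 1)) atTop (𝓝 0) := by
      simpa using (he0.mul (hη0.const_add (σ - 1))).add hinv
    refine h2.congr fun n => ?_
    simp only [he]
    field_simp
    ring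
  have hκ1 : Tendsto κ atTop (𝓝 1) := by
    have h2 : Tendsto (fun n : ℕ => Real.exp (-e n * (σ + n + η n))) atTop (𝓝 1) := by
      have h3 := (Real.continuous_exp.tendsto _).comp hen.neg
      simpa [Function.comp_def] using h3
    have h : Tendsto κ atTop (𝓝 ((1 * 1) ^ 2)) := (h2.mul hr1).pow 2
    simpa using h
  refine ⟨e, κ, fun n => by positivity, he0, hκ1, ?_⟩
  filter_upwards [hX.eventually_const_lt zero_lt_one] with n hn V hV s t ht htσ
  have hy_nn : 0 ≤ y n := by
    have := Real.sin_nonneg_of_nonneg_of_le_pi hσ0.le hσpi.le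
    positivity
  have hη_nn : 0 ≤ η n := Real.arctan_nonneg.2 (div_nonneg hy_nn hn.le)
  have hret := spiralFlow_shearFlow_spiralFlow hσ (T := n) (y := y n) rfl hn
  have half := fun s t ht => hV.half_turn_le h0 h1 n.cast_nonneg hη_nn hret s (t := t) ht
  refine ⟨?_, ?_⟩
  · have b1 := half s t htσ
    have b2 := half (-(Real.exp (-e n * (σ + n + η n)) * r n * s)) 0 hσ0.le
    rw [mul_zero, Real.exp_zero, mul_one, spiralFlow_zero] at b2
    refine le_trans (le_of_eq ?_) (b2.trans b1)
    congr 2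
    simp only [hκ, hr, hη]
    ring
  · have b := hV.spiralFlow_le h1 ht (s • planeE)
    rwa [spiralFlow_smul, smul_smul, mul_comm] at b

/-! ### Transcendence of the logarithmic spiral -/

/-- The substitution of univariate polynomials into a trivariate one. -/
lemma eval_aeval_fin_three (G : MvPolynomial (Fin 3) ℝ) (f g h : Polynomial ℝ) (r : ℝ) :
    (MvPolynomial.aeval ![f, g, h] G).eval r =
      MvPolynomial.eval ![f.eval r, g.eval r, h.eval r] G := by
  rw [MvPolynomial.aeval_def, MvPolynomial.polynomial_eval_eval₂, ← MvPolynomial.eval₂_id]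
  refine congrArg₂ (fun a b => MvPolynomial.eval₂ a b G) ?_ ?_
  · ext x
    simp
  · funext i
    fin_cases i <;> rfl

lemma exists_polar (x y : ℝ) : ∃ r θ : ℝ, x = r * Real.cos θ ∧ y = r * Real.sin θ := by
  refine ⟨‖(⟨x, y⟩ : ℂ)‖, Complex.arg ⟨x, y⟩, ?_, ?_⟩
  · rw [Complex.norm_mul_cos_arg]
  · rw [Complex.norm_mul_sin_arg]

/-- The logarithmic spiral is transcendental: a polynomial that vanishes on the scaled arcs,
with third variable a nonconstant polynomial in the scale, is zero. -/
lemma eq_zero_of_eval_spiral {σ : ℝ} (hσ : 0 < σ) {G : MvPolynomial (Fin 3) ℝ}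
    {q : Polynomial ℝ} (hq : q ≠ 0) (hq0 : q.coeff 0 = 0)
    (h : ∀ s t : ℝ, 0 < s → 0 ≤ t → t ≤ σ →
      MvPolynomial.eval ![s * (Real.exp (-t) * Real.cos t), s * (Real.exp (-t) * Real.sin t),
        q.eval s] G = 0) : G = 0 := by
  -- Analyticity in `t` continues the relation from the arc to the whole spiral.
  have hall : ∀ s t : ℝ, 0 < s → MvPolynomial.eval ![s * (Real.exp (-t) * Real.cos t),
      s * (Real.exp (-t) * Real.sin t), q.eval s] G = 0 := by
    intro s t hs
    have hcos : AnalyticOnNhd ℝ Real.cos univ := fun z _ => Real.analyticAt_cos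
    have hsin : AnalyticOnNhd ℝ Real.sin univ := fun z _ => Real.analyticAt_sin
    have hexp : AnalyticOnNhd ℝ (fun t => Real.exp (-t)) univ := fun z _ =>
      (analyticAt_rexp (x := -z)).comp analyticAt_id.neg
    have han : AnalyticOnNhd ℝ (fun t : ℝ => MvPolynomial.aeval
        ![s * (Real.exp (-t) * Real.cos t), s * (Real.exp (-t) * Real.sin t), q.eval s] G)
        univ := by
      refine AnalyticOnNhd.aeval_mvPolynomial (fun i => ?_) G
      fin_cases i
      · exact analyticOnNhd_const.mul (hexp.mul hcos)
      · exact analyticOnNhd_const.mul (hexp.mul hsin)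
      · exact analyticOnNhd_const
    have heq := han.eq_of_eventuallyEq (g := fun _ => 0) analyticOnNhd_const (z₀ := σ / 2) (by
      filter_upwards [Icc_mem_nhds (half_pos hσ) (half_lt_self hσ)] with t ht
      exact h s t hs ht.1 ht.2)
    exact congrFun heq t
  -- Every ray from the origin meets the spiral at infinitely many radii, one for each turn `k`, so
  -- the polynomial vanishes on each line through the origin.
  have hplane : ∀ s x y : ℝ, 0 < s → MvPolynomial.eval ![x, y, q.eval s] G = 0 := by
    intro s x y hs
    obtain ⟨r, θ, rfl, rfl⟩ := exists_polar x y
    have hz : MvPolynomial.aeval ![Polynomial.X * Polynomial.C (Real.cos θ),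
        Polynomial.X * Polynomial.C (Real.sin θ), Polynomial.C (q.eval s)] G = 0 := by
      refine Polynomial.eq_zero_of_infinite_isRoot _ ?_
      have hinj : Function.Injective fun k : ℕ => s * Real.exp (-(θ + k * (2 * Real.pi))) := by
        intro a b hab
        have h1 := Real.exp_injective (mul_left_cancel₀ hs.ne' hab)
        have h2 : (a : ℝ) * (2 * Real.pi) = b * (2 * Real.pi) := by linarith
        exact_mod_cast mul_right_cancel₀ Real.two_pi_pos.ne' h2
      refine (infinite_range_of_injective hinj).mono ?_
      rintro _ ⟨k, rfl⟩
      have h1 := hall s (θ + k * (2 * Real.pi)) hs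
      rw [Real.cos_add_nat_mul_two_pi, Real.sin_add_nat_mul_two_pi] at h1
      simp only [mem_ofPred_eq, Polynomial.IsRoot, eval_aeval_fin_three, Polynomial.eval_mul,
        Polynomial.eval_X, Polynomial.eval_C]
      rw [mul_assoc, mul_assoc]
      exact h1
    have := congrArg (Polynomial.eval r) hz
    simpa only [eval_aeval_fin_three, Polynomial.eval_mul, Polynomial.eval_X, Polynomial.eval_C,
      Polynomial.eval_zero] using this
  refine MvPolynomial.funext fun v => ?_
  have hv : v = ![v 0, v 1, v 2] := by
    funext i
    fin_cases i <;> rfl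
  -- With the first two variables fixed, `G` becomes a univariate polynomial vanishing on the values
  -- of `q` at positive scales. As `q` is nonconstant, it must be zero.
  have hcomp : (MvPolynomial.aeval ![Polynomial.C (v 0), Polynomial.C (v 1),
      (Polynomial.X : Polynomial ℝ)] G).comp q = 0 := by
    refine Polynomial.eq_zero_of_infinite_isRoot _ ((Ioi_infinite (0 : ℝ)).mono fun s hs => ?_)
    simp only [mem_ofPred_eq, Polynomial.IsRoot, Polynomial.eval_comp, eval_aeval_fin_three,
      Polynomial.eval_C, Polynomial.eval_X]
    exact hplane s _ _ hs
  rcases Polynomial.comp_eq_zero_iff.1 hcomp with h1 | h1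
  · have := congrArg (Polynomial.eval (v 2)) h1
    simp only [eval_aeval_fin_three, Polynomial.eval_C, Polynomial.eval_X,
      Polynomial.eval_zero] at this
    rw [map_zero, hv]
    exact this
  · refine absurd ?_ hq
    rw [h1.2, hq0, Polynomial.C_0]

/-! ### Algebraic data of bounded degree -/

/-- On the ray through a point a piecewise-polynomial function is a polynomial in the scale. -/
lemma PPF.exists_ray_polynomial {n : ℕ} (V : PPF n) (x : EuclideanSpace ℝ (Fin n)) :
    ∃ q : Polynomial ℝ, q.natDegree ≤ V.totalDegree ∧ ∀ s : ℝ, 0 ≤ s →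
      V.toFun (s • x) = q.eval s := by
  obtain ⟨j, hj⟩ := mem_iUnion.1 (V.cover.symm ▸ mem_univ x : x ∈ ⋃ j, V.cone j)
  set q : Polynomial ℝ := MvPolynomial.aeval
    (fun i => Polynomial.C (x i) * Polynomial.X) (V.poly j) with hq
  have hpos : ∀ s ∈ Ioi (0 : ℝ), V.toFun (s • x) = q.eval s := by
    intro s hs
    rw [V.eq_poly j _ (V.isCone j x hj s hs), hq, MvPolynomial.aeval_def,
      MvPolynomial.polynomial_eval_eval₂, ← MvPolynomial.eval₂_id]
    refine congrArg₂ (fun a b => MvPolynomial.eval₂ a b (V.poly j)) ?_ ?_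
    · ext y
      simp
    · funext i
      rw [Polynomial.eval_mul, Polynomial.eval_C, Polynomial.eval_X, PiLp.smul_apply,
        smul_eq_mul, mul_comm]
  refine ⟨q, ?_, ?_⟩
  · have h1 := MvPolynomial.aeval_natDegree_le (m := V.totalDegree) (n := 1) (V.poly j)
      (le_max_of_le_right (Finset.le_sup (f := fun j => (V.poly j).totalDegree)
        (Finset.mem_univ j)))
      (fun i => Polynomial.C (x i) * Polynomial.X)
      (fun i => (Polynomial.natDegree_C_mul_le _ _).trans Polynomial.natDegree_X_le)
    rwa [mul_one] at h1
  -- The open ray lies in one cone, but the origin may lie in another; continuity supplies `s = 0`.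
  · have hc1 : Continuous fun s : ℝ => V.toFun (s • x) := V.continuous.comp (by fun_prop)
    have hcl := (show EqOn (fun s : ℝ => V.toFun (s • x)) (fun s => q.eval s) (Ioi 0)
      from hpos).closure hc1 q.continuous
    rw [closure_Ioi] at hcl
    exact fun s hs => hcl hs

/-- A multiple of a piecewise-polynomial function satisfies an algebraic equation of bounded
degree. -/
lemma PPF.exists_algebraic_relation (V : PPF 2) {N : ℕ} (hN : V.totalDegree ≤ N) (a : ℝ) :
    ∃ F : MvPolynomial (Fin 3) ℝ, F ≠ 0 ∧ F.totalDegree ≤ N * (N + 1) ∧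
      ∀ x : Plane, MvPolynomial.eval ![x 0, x 1, a * V.toFun x] F = 0 := by
  have hev : ∀ j (x y w : ℝ), MvPolynomial.eval ![x, y, w] (MvPolynomial.X 2 -
      MvPolynomial.C a * MvPolynomial.rename (Fin.castSucc : Fin 2 → Fin 3) (V.poly j)) =
      w - a * MvPolynomial.eval ![x, y] (V.poly j) := by
    intro j x y w
    rw [map_sub, map_mul, MvPolynomial.eval_X, MvPolynomial.eval_C, MvPolynomial.eval_rename]
    have : (![x, y, w] : Fin 3 → ℝ) ∘ (Fin.castSucc : Fin 2 → Fin 3) = ![x, y] := by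
      funext i
      fin_cases i <;> rfl
    rw [this]
    rfl
  -- At each point some factor vanishes. The product does not depend on the shape of the cones, only
  -- on their number; `N + 1` bounds each factor's degree even when `N = 0`.
  refine ⟨∏ j, (MvPolynomial.X 2 -
    MvPolynomial.C a * MvPolynomial.rename (Fin.castSucc : Fin 2 → Fin 3) (V.poly j)), ?_, ?_, ?_⟩
  · refine Finset.prod_ne_zero_iff.2 fun j _ h => ?_
    have h1 := hev j 0 0 (a * MvPolynomial.eval ![0, 0] (V.poly j) + 1)
    rw [h, map_zero] at h1
    linarith
  · refine (MvPolynomial.totalDegree_finsetProd _ _).trans ?_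
    have h1 : ∀ j ∈ Finset.univ, (MvPolynomial.X 2 - MvPolynomial.C a *
        MvPolynomial.rename (Fin.castSucc : Fin 2 → Fin 3) (V.poly j)).totalDegree ≤ N + 1 := by
      intro j hj
      have h2 : (V.poly j).totalDegree ≤ N := le_trans (le_max_of_le_right
        (Finset.le_sup (f := fun j => (V.poly j).totalDegree) hj)) hN
      refine (MvPolynomial.totalDegree_sub _ _).trans (max_le ?_ ?_)
      · rw [MvPolynomial.totalDegree_X]
        omega
      · refine (MvPolynomial.totalDegree_mul _ _).trans ?_
        rw [MvPolynomial.totalDegree_C, zero_add]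
        exact (MvPolynomial.totalDegree_rename_le _ _).trans (by omega)
    refine (Finset.sum_le_card_nsmul _ _ _ h1).trans ?_
    rw [Finset.card_univ, Fintype.card_fin, smul_eq_mul]
    exact Nat.mul_le_mul_right _ ((le_max_left _ _).trans hN)
  · intro x
    obtain ⟨j, hj⟩ := mem_iUnion.1 (V.cover.symm ▸ mem_univ x : x ∈ ⋃ j, V.cone j)
    rw [map_prod]
    refine Finset.prod_eq_zero (Finset.mem_univ j) ?_
    have hx : (fun i => x i) = ![x 0, x 1] := by
      funext i
      fin_cases i <;> rfl
    rw [hev, V.eq_poly j x hj, hx, sub_self]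

/-- Exponents of trivariate monomials whose partial degrees are at most `D`. -/
noncomputable def boxExponents (D : ℕ) : Finset (Fin 3 →₀ ℕ) :=
  Finset.Iic (Finsupp.equivFunOnFinite.symm fun _ => D)

/-- The trivariate polynomial with given coefficients. -/
noncomputable def boxPoly (D : ℕ) (c : boxExponents D → ℝ) : MvPolynomial (Fin 3) ℝ :=
  ∑ m : boxExponents D, MvPolynomial.monomial m.1 (c m)

lemma eval_boxPoly (D : ℕ) (c : boxExponents D → ℝ) (v : Fin 3 → ℝ) :
    MvPolynomial.eval v (boxPoly D c) = ∑ m : boxExponents D, c m * ∏ i, v i ^ m.1 i := by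
  simp [boxPoly, MvPolynomial.eval_monomial, Finsupp.prod_fintype]

lemma coeff_boxPoly (D : ℕ) (c : boxExponents D → ℝ) (m : boxExponents D) :
    MvPolynomial.coeff m.1 (boxPoly D c) = c m := by
  simp only [boxPoly, MvPolynomial.coeff_sum, MvPolynomial.coeff_monomial]
  rw [Finset.sum_eq_single m]
  · simp
  · intro b _ hb
    rw [if_neg fun h => hb (Subtype.ext h)]
  · simp

lemma exists_boxPoly_eq (D : ℕ) (F : MvPolynomial (Fin 3) ℝ) (hF : F.totalDegree ≤ D) :
    boxPoly D (fun m => MvPolynomial.coeff m.1 F) = F := by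
  ext m
  by_cases hm : m ∈ boxExponents D
  · exact coeff_boxPoly D _ ⟨m, hm⟩
  · have h1 : MvPolynomial.coeff m F = 0 := by
      by_contra hne
      refine hm (Finset.mem_Iic.2 fun i => ?_)
      have h2 := MvPolynomial.le_totalDegree (MvPolynomial.mem_support_iff.2 hne)
      rw [Finsupp.sum_fintype _ _ (fun _ => rfl)] at h2
      exact (Finset.single_le_sum (f := fun i => m i) (fun _ _ => Nat.zero_le _)
        (Finset.mem_univ i)).trans (h2.trans hF)
    rw [h1]
    simp only [boxPoly, MvPolynomial.coeff_sum, MvPolynomial.coeff_monomial]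
    refine Finset.sum_eq_zero fun b _ => ?_
    rw [if_neg]
    rintro rfl
    exact hm b.2

/-- Unit coefficient vectors in a fixed finite-dimensional space have nonzero limit points. -/
lemma exists_normalized_coeffs {D : ℕ} {F : MvPolynomial (Fin 3) ℝ} (hF0 : F ≠ 0)
    (hF : F.totalDegree ≤ D) : ∃ c : boxExponents D → ℝ, ‖c‖ = 1 ∧
      ∀ v, MvPolynomial.eval v F = 0 → ∑ m : boxExponents D, c m * ∏ i, v i ^ m.1 i = 0 := by
  set b : boxExponents D → ℝ := fun m => MvPolynomial.coeff m.1 F with hb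
  have hbF := exists_boxPoly_eq D F hF
  have hb0 : b ≠ 0 := by
    intro h
    rw [← hb, h] at hbF
    refine hF0 ?_
    rw [← hbF]
    simp [boxPoly]
  refine ⟨‖b‖⁻¹ • b, norm_smul_inv_norm hb0, fun v hv => ?_⟩
  rw [← hbF, eval_boxPoly] at hv
  simp only [Pi.smul_apply, smul_eq_mul, mul_assoc, ← Finset.mul_sum]
  rw [hv, mul_zero]

/-- The factor `a` later rescales the whole Lyapunov function, so that its ray polynomial has a
nonzero limit along a subsequence. -/
lemma exists_normalized_polynomial {N : ℕ} {q : Polynomial ℝ} (hq0 : q ≠ 0)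
    (hq : q.natDegree ≤ N) : ∃ a : ℝ, 0 < a ∧ ∃ b : Fin (N + 1) → ℝ, ‖b‖ = 1 ∧
      (∀ s, a * q.eval s = ∑ i, b i * s ^ (i : ℕ)) := by
  set b : Fin (N + 1) → ℝ := fun i => q.coeff i with hb
  have hev : ∀ s, q.eval s = ∑ i, b i * s ^ (i : ℕ) := fun s => by
    rw [Polynomial.eval_eq_sum_range' (Nat.lt_succ_of_le hq),
      Finset.sum_range (n := N + 1) fun i => q.coeff i * s ^ i]
  have hb0 : b ≠ 0 := by
    intro h
    refine hq0 (Polynomial.funext fun s => ?_)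
    rw [hev, h]
    simp
  refine ⟨‖b‖⁻¹, inv_pos.2 (norm_pos_iff.2 hb0), ‖b‖⁻¹ • b, norm_smul_inv_norm hb0, fun s => ?_⟩
  simp only [Pi.smul_apply, smul_eq_mul, mul_assoc, ← Finset.mul_sum]
  rw [hev]

/-- Normalized data attached to a piecewise-polynomial function of degree at most `N`: its
restriction to a ray and an algebraic relation. -/
lemma PPF.exists_normalized_data (V : PPF 2) {N : ℕ} (hN : V.totalDegree ≤ N) (h0 : V.toFun 0 = 0)
    (hpos : 0 < V.toFun planeE) :
    ∃ a : ℝ, 0 < a ∧ ∃ b ∈ Metric.sphere (0 : Fin (N + 1) → ℝ) 1,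
      ∃ c ∈ Metric.sphere (0 : boxExponents (N * (N + 1)) → ℝ) 1,
      (∀ s : ℝ, 0 ≤ s → a * V.toFun (s • planeE) = ∑ i, b i * s ^ (i : ℕ)) ∧ b 0 = 0 ∧
      ∀ x : Plane, ∑ m, c m * ∏ i, ![x 0, x 1, a * V.toFun x] i ^ m.1 i = 0 := by
  obtain ⟨q, hqdeg, hq⟩ := V.exists_ray_polynomial planeE
  have hq0 : q ≠ 0 := by
    rintro rfl
    have := hq 1 zero_le_one
    rw [one_smul, Polynomial.eval_zero] at this
    exact hpos.ne' this
  obtain ⟨a, ha, b, hb, hbq⟩ := exists_normalized_polynomial hq0 (hqdeg.trans hN)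
  obtain ⟨F, hF0, hF, hFV⟩ := V.exists_algebraic_relation hN a
  obtain ⟨c, hc, hcF⟩ := exists_normalized_coeffs hF0 hF
  have hray : ∀ s : ℝ, 0 ≤ s → a * V.toFun (s • planeE) = ∑ i, b i * s ^ (i : ℕ) :=
    fun s hs => by rw [hq s hs, hbq]
  refine ⟨a, ha, b, by simpa using hb, c, by simpa using hc, hray, ?_, fun x => hcF _ (hFV x)⟩
  have h1 := hray 0 le_rfl
  rw [zero_smul, h0, mul_zero, Fin.sum_univ_succ] at h1
  simpa using h1.symm

/-! ### The compactness argument -/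

/-- The degrees of piecewise-polynomial common Lyapunov functions blow up along the family. -/
lemma exists_large_degree {U : Set ℝ} (h0 : (0 : ℝ) ∈ U) (h1 : (1 : ℝ) ∈ U) {p σ : ℝ}
    (hσ0 : 0 < σ) (hσpi : σ < Real.pi) (hσ : spiralObs p σ planeE = -1) (N : ℕ) :
    ∃ e : ℝ, 0 < e ∧ ∀ V : PPF 2, IsCLF U (spiralMatrix e) (shearMatrix p e) V.toFun →
      N < V.totalDegree := by
  obtain ⟨e, κ, hepos, he0, hκ, hsq⟩ := exists_squeeze h0 h1 hσ0 hσpi hσ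
  by_contra! hcon
  choose V hV hVN using fun n => hcon (e n) (hepos n)
  have hE : planeE ≠ 0 := fun h => by
    have := congrArg (fun x : Plane => x 0) h
    simp at this
  choose a ha b hb c hc hray hb0 hrel using fun n =>
    (V n).exists_normalized_data (hVN n) (hV n).map_zero ((hV n).pos _ hE)
  -- Only the ray polynomials and the relations need to converge; no limit of the Lyapunov functions
  -- or of their cones is taken.
  obtain ⟨⟨b', c'⟩, ⟨hb', hc'⟩, φ, hφ, hlim⟩ :=
    ((isCompact_sphere (0 : Fin (N + 1) → ℝ) 1).prod
      (isCompact_sphere (0 : boxExponents (N * (N + 1)) → ℝ) 1)).tendsto_subseq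
      (x := fun n => (b n, c n)) (fun n => ⟨hb n, hc n⟩)
  have hblim : Tendsto (fun n => b (φ n)) atTop (𝓝 b') := (continuous_fst.tendsto _).comp hlim
  have hclim : Tendsto (fun n => c (φ n)) atTop (𝓝 c') := (continuous_snd.tendsto _).comp hlim
  set q : Polynomial ℝ := ∑ i : Fin (N + 1), Polynomial.C (b' i) * Polynomial.X ^ (i : ℕ) with hq
  have hqeval : ∀ s, q.eval s = ∑ i, b' i * s ^ (i : ℕ) := fun s => by
    simp [hq, Polynomial.eval_finsetSum]
  have hqcoeff : ∀ i : Fin (N + 1), q.coeff i = b' i := by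
    intro i
    simp only [hq, Polynomial.finsetSum_coeff, Polynomial.coeff_C_mul, Polynomial.coeff_X_pow]
    rw [Finset.sum_eq_single i]
    · simp
    · intro j _ hj
      rw [if_neg fun h => hj (Fin.ext h.symm), mul_zero]
    · simp
  have hq0 : q ≠ 0 := by
    intro h
    have : b' = 0 := funext fun i => by rw [← hqcoeff, h]; simp
    simp [this] at hb'
  have hqc : q.coeff 0 = 0 := by
    have h2 := hqcoeff 0
    have h3 : Tendsto (fun n => b (φ n) 0) atTop (𝓝 (b' 0)) :=
      ((continuous_apply 0).tendsto b').comp hblim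
    simp only [hb0] at h3
    rw [Fin.val_zero] at h2
    rw [h2]
    exact tendsto_nhds_unique h3 tendsto_const_nhds
  have hG : boxPoly (N * (N + 1)) c' = 0 := by
    refine eq_zero_of_eval_spiral hσ0 hq0 hqc fun s t hs ht htσ => ?_
    have hsum : ∀ (r : ℕ → ℝ), Tendsto r atTop (𝓝 s) →
        Tendsto (fun n => ∑ i, b (φ n) i * r n ^ (i : ℕ)) atTop (𝓝 (q.eval s)) := by
      intro r hr
      rw [hqeval]
      refine tendsto_finsetSum _ fun i _ => ?_
      exact (((continuous_apply i).tendsto b').comp hblim).mul (hr.pow _)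
    have hφt := hφ.tendsto_atTop
    have hκs : Tendsto (fun n => κ (φ n) * s) atTop (𝓝 s) := by
      simpa using (hκ.comp hφt).mul_const s
    -- Both ends of the squeeze are ray values at scales tending to `s`, hence tend to `q.eval s`.
    have hw : Tendsto (fun n => a (φ n) * (V (φ n)).toFun
        ((s * Real.exp (-e (φ n) * t)) • spiralFlow t planeE)) atTop (𝓝 (q.eval s)) := by
      refine tendsto_of_tendsto_of_tendsto_of_le_of_le' (hsum _ hκs) (hsum _ tendsto_const_nhds)
        ?_ ?_
      · filter_upwards [hφt.eventually hsq, hκs.eventually_const_lt hs] with n hn hn'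
        rw [← hray (φ n) _ hn'.le]
        exact mul_le_mul_of_nonneg_left (hn _ (hV _) s t ht htσ).1 (ha _).le
      · filter_upwards [hφt.eventually hsq] with n hn
        rw [← hray (φ n) _ hs.le]
        exact mul_le_mul_of_nonneg_left (hn _ (hV _) s t ht htσ).2 (ha _).le
    have hexp : Tendsto (fun n => s * Real.exp (-e (φ n) * t)) atTop (𝓝 s) := by
      have h3 : Tendsto (fun n => -e (φ n) * t) atTop (𝓝 0) := by
        simpa using ((he0.comp hφt).neg).mul_const t
      have h4 := ((Real.continuous_exp.tendsto _).comp h3).const_mul s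
      simpa using h4
    have hx : ∀ i : Fin 2, Tendsto
        (fun n => ((s * Real.exp (-e (φ n) * t)) • spiralFlow t planeE) i) atTop
        (𝓝 (s * spiralFlow t planeE i)) := fun i => hexp.mul_const _
    have hv : Tendsto (fun n => ![((s * Real.exp (-e (φ n) * t)) • spiralFlow t planeE) 0,
        ((s * Real.exp (-e (φ n) * t)) • spiralFlow t planeE) 1,
        a (φ n) * (V (φ n)).toFun ((s * Real.exp (-e (φ n) * t)) • spiralFlow t planeE)]) atTop
        (𝓝 ![s * spiralFlow t planeE 0, s * spiralFlow t planeE 1, q.eval s]) := by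
      refine tendsto_pi_nhds.2 fun i => ?_
      fin_cases i
      · exact hx 0
      · exact hx 1
      · exact hw
    have hlimsum := tendsto_finsetSum Finset.univ fun (m : boxExponents (N * (N + 1))) _ =>
      (((continuous_apply m).tendsto c').comp hclim).mul
        (tendsto_finsetProd Finset.univ fun (i : Fin 3) _ =>
          ((tendsto_pi_nhds.1 hv i).pow (m.1 i)))
    simp only [Function.comp_apply, hrel] at hlimsum
    rw [eval_boxPoly]
    have h5 := tendsto_nhds_unique hlimsum tendsto_const_nhds
    simpa [spiralFlow_apply_zero, spiralFlow_apply_one] using h5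
  -- Vanishing of the limiting relation contradicts the unit norm of its coefficient vector.
  have hc0 : c' = 0 := funext fun m => by rw [← coeff_boxPoly _ c' m, hG]; simp
  simp [hc0] at hc'

end

theorem mainTheorem4 (U : Set ℝ) (hU : U = Set.Icc (0 : ℝ) 1 ∨ U = {(0 : ℝ), 1}) :
    ∀ N : ℕ, ∃ A B : Matrix (Fin 2) (Fin 2) ℝ, (A, B) ∈ xiGUES U ∧
      ∃ m : ℕ, IsLeast (ppfCLFDegrees U A B) m ∧ N < m := by
  intro N
  have hsub : U ⊆ Set.Icc 0 1 := by
    rcases hU with rfl | rfl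
    · exact subset_rfl
    · rintro x (rfl | rfl) <;> simp
  have h0 : (0 : ℝ) ∈ U := by rcases hU with rfl | rfl <;> simp
  have h1 : (1 : ℝ) ∈ U := by rcases hU with rfl | rfl <;> simp
  obtain ⟨p, σ, hσ0, hσpi, hσ, hp⟩ := exists_critical_slope
  obtain ⟨e, he, hV⟩ := exists_large_degree h0 h1 hσ0 hσpi hσ N
  obtain ⟨hmem, hne⟩ := mem_xiGUES_and_nonempty hsub hp he
  refine ⟨spiralMatrix e, shearMatrix p e, hmem, sInf _, ⟨Nat.sInf_mem hne, fun _ h =>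
    Nat.sInf_le h⟩, ?_⟩
  obtain ⟨V, hVclf, hVdeg⟩ := Nat.sInf_mem hne
  rw [← hVdeg]
  exact hV V hVclf
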